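/- \textbf{Setting.} Let $p(x\mid z)$, $x\in\mathbb R^{d_x}$, $z\in\mathbb R^{d_z}$, be the (jointly measurable) true conditional density of $x$ given $z$, let $p(z)$ be the density of $z$, and let $\{p(x\mid z;\theta):\theta\in\Theta\}$, $\Theta\subseteq\mathbb R^{d_\Theta}$, be a family of conditional densities; put $p(x,z)=p(x\mid z)p(z)$, $p(x,z;\theta)=p(x\mid z;\theta)p(z)$ and $s(x,z;\theta)=\nabla_x\log p(x\mid z;\theta)$. Let $p_v$ be a probability distribution on $\mathbb R^{d_x}$. For $\theta\in\Theta$ define $$f(\theta;x,z,v)=v^T\nabla_x s(x,z;\theta)\,v+\tfrac12\,(v^Ts(x,z;\theta))^2,\qquad \mathcal J_\theta=\mathbb E_{(x,z)\sim p(x,z),\,v\sim p_v}[f(\theta;x,z,v)],$$ with $v$ independent of $(x,z)$. Let $(x_i,z_i)$, $i\ge1$, be i.i.d. from $p(x,z)$ and $v_{ij}$, $i\ge 1$, $1\le j\le m$, i.i.d. from $p_v$ and independent of the $(x_i,z_i)$, with $m\ge1$ fixed, and put $$\widehat{\mathcal J}_\theta=\frac1{nm}\sum_{i=1}^n\sum_{j=1}^m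 f(\theta;x_i,z_i,v_{ij}).$$ \textbf{Assumptions.} (1) For every $z$ and every $\theta\in\Theta$, $\log p(x\mid z;\theta)$, $\log p(x\mid z)$, $s(x,z;\theta)$ and $\nabla_x\log p(x\mid z)$ are differentiable in $x$, $\mathbb E_{x\sim p(x\mid z)}\|s(x,z;\theta)\|_2^2<\infty$ and $\mathbb E_{x\sim p(x\mid z)}\|\nabla_x\log p(x\mid z)\|_2^2<\infty$. (2) $\mathbb E_{p_v}\|v\|_2^2<\infty$ and $\mathbb E_{p_v}[vv^T]\succ0$. (3) $\lim_{\|x\|\to\infty}s(x,z;\theta)\,p(x\mid z)=0$ for every $z$ and every $\theta\in\Theta$. (4) There is $\theta^*\in\Theta$ with $p(x,z)=p(x,z;\theta^*)$, and for $\theta\in\Theta$, $\theta\ne\theta^*$, the distributions with densities $p(x,z;\theta)$ and $p(x,z;\theta^*)$ are different (i.e. the densities are not equal almost everywhere). (5) $p(x,z;\theta)>0$ for all $\theta\in\Theta$ and all $(x,z)$. (6) $\Theta$ is compact. (7) For all $\theta_1,\theta_2\in\Theta$ and all $(x,z)$, $\|\nabla_x s(x,z;\theta_1)-\nabla_x s(x,z;\theta_2)\|_F\le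 L_1(x,z)\|\theta_1-\theta_2\|_2$ and $\|s(x,z;\theta_1)s(x,z;\theta_1)^T-s(x,z;\theta_2)s(x,z;\theta_2)^T\|_F\le L_2(x,z)\|\theta_1-\theta_2\|_2$, where $\mathbb E_{p(x,z)}[L_1^2]<\infty$ and $\mathbb E_{p(x,z)}[L_2^2]<\infty$. (8) $\mathbb E_{p_v}\|vv^T\|_F^2<\infty$. \textbf{Theorem (Consistency).} Under Assumptions (1)–(8), for every $m\ge1$, every sequence of minimizers $\hat\theta_{n,m}\in\arg\min_{\theta\in\Theta}\widehat{\mathcal J}_\theta$ converges in probability to $\theta^*$ as $n\to\infty$. If moreover $\mathcal J_\theta$ is well defined (i.e. $f(\theta;x,z,v)$ is integrable for every $\theta\in\Theta$), then $\mathbb E\big[\sup_{\theta\in\Theta}|\widehat{\mathcal J}_\theta-\mathcal J_\theta|\big]\to0$ as $n\to\infty$, and there is an absolute constant $C$ (independent of $n$, $m$, the dimensions and all the other data) such that for every $n\ge1$ $$\mathbb E\Big[\sup_{\theta\in\Theta}\big|(\widehat{\mathcal J}_\theta-\mathcal J_\theta)-(\widehat{\mathcal J}_{\theta^*}-\mathcal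 J_{\theta^*})\big|\Big]\le C\,\operatorname{diam}(\Theta)\sqrt{\frac{d_\Theta}{n}}\,\sqrt{\mathbb E[L^2(x,z,v)]},\qquad L(x,z,v)=\big(L_1(x,z)+\tfrac12L_2(x,z)\big)\|vv^T\|_F .$$ -/

import Mathlib

open MeasureTheory ProbabilityTheory Filter Topology
open scoped ENNReal

noncomputable section

namespace CSSM

open scoped Matrix Matrix.Norms.Frobenius

/-- `ℝᵈ` with its Euclidean norm. -/
abbrev E (d : ℕ) : Type := EuclideanSpace ℝ (Fin d)

variable {dx dz d : ℕ}

/-- A probability density on `ℝᵈ` with respect to Lebesgue measure. -/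
structure IsDensity (q : E d → ℝ) : Prop where
  measurable : Measurable q
  nonneg : ∀ z, 0 ≤ q z
  lintegral_eq_one : ∫⁻ z, ENNReal.ofReal (q z) = 1

/-- A conditional probability density `p(x|z)`, jointly measurable in `(x, z)`; its values are
written `p x z`. -/
structure IsCondDensity (p : E dx → E dz → ℝ) : Prop where
  measurable : Measurable (Function.uncurry p)
  nonneg : ∀ x z, 0 ≤ p x z
  lintegral_eq_one : ∀ z, ∫⁻ x, ENNReal.ofReal (p x z) = 1

/-- The joint density `p(x, z) = p(x|z) p(z)`. -/
def jointDensity (p : E dx → E dz → ℝ) (q : E dz → ℝ) (x : E dx) (z : E dz) : ℝ :=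
  p x z * q z

/-- The probability measure on `ℝ^dx` with density `p(·|z)`. -/
def condLaw (p : E dx → E dz → ℝ) (z : E dz) : Measure (E dx) :=
  volume.withDensity fun x => ENNReal.ofReal (p x z)

/-- The law of `(x, z)`, with density `p(x|z) p(z)`. -/
def jointLaw (p : E dx → E dz → ℝ) (q : E dz → ℝ) : Measure (E dx × E dz) :=
  volume.withDensity fun w => ENNReal.ofReal (jointDensity p q w.1 w.2)

/-- The conditional score `s(x, z) = ∇ₓ log p(x|z)`. -/
def score (p : E dx → E dz → ℝ) (x : E dx) (z : E dz) : E dx :=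
  gradient (fun x' => Real.log (p x' z)) x

/-- The Jacobian matrix `∇ₓ s(x, z)` of a vector field `s` in `x`: the entry `(i, j)` is
`∂ s_i / ∂ x_j`. -/
def jacobian (s : E dx → E dz → E dx) (x : E dx) (z : E dz) : Matrix (Fin dx) (Fin dx) ℝ :=
  Matrix.of fun i j => (fderiv ℝ (fun x' => s x' z) x (EuclideanSpace.single j 1)).ofLp i

/-- The outer product `v vᵀ`. -/
def outer (v : E dx) : Matrix (Fin dx) (Fin dx) ℝ :=
  Matrix.vecMulVec v.ofLp v.ofLp

/-- The one-sample loss `vᵀ ∇ₓs(x, z) v + ½ (vᵀ s(x, z))²`. -/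
def loss (s : E dx → E dz → E dx) (x : E dx) (z : E dz) (v : E dx) : ℝ :=
  v.ofLp ⬝ᵥ (jacobian s x z *ᵥ v.ofLp) + 1 / 2 * (v.ofLp ⬝ᵥ (s x z).ofLp) ^ 2

/-- The population objective `J`: the expectation of the loss under
`(x, z) ∼ P` and, independently, `v ∼ pv`. -/
def objective (s : E dx → E dz → E dx) (P : Measure (E dx × E dz)) (pv : Measure (E dx)) : ℝ :=
  ∫ w, loss s w.1.1 w.1.2 w.2 ∂(P.prod pv)

/-- The empirical objective `(1 / (n m)) ∑_{i < n} ∑_{j < m} loss(xᵢ, zᵢ, vᵢⱼ)`. -/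
def empObjective (s : E dx → E dz → E dx) {m : ℕ} (n : ℕ)
    (x : ℕ → E dx) (z : ℕ → E dz) (v : ℕ → Fin m → E dx) : ℝ :=
  1 / ((n : ℝ) * m) * ∑ i ∈ Finset.range n, ∑ j : Fin m, loss s (x i) (z i) (v i j)

/-- A conditional density `p(x|z)` with differentiable log-density, differentiable score, and
score square integrable under `r(·|z)`, for every `z`. -/
structure RegularScore (r p : E dx → E dz → ℝ) : Prop where
  log_differentiable : ∀ z, Differentiable ℝ fun x => Real.log (p x z)
  score_differentiable : ∀ z, Differentiable ℝ fun x => score p x z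
  sq_integrable : ∀ z, Integrable (fun x => ‖score p x z‖ ^ 2) (condLaw r z)

/-- Regularity of the projection vectors: `E‖v‖² < ∞` and `E[v vᵀ] ≻ 0`. -/
structure RegularProjection (pv : Measure (E dx)) : Prop where
  sq_integrable : Integrable (fun v : E dx => ‖v‖ ^ 2) pv
  posDef : (Matrix.of fun i j => ∫ v : E dx, outer v i j ∂pv).PosDef

/-- Boundary condition: `s(x, z) p(x|z) → 0` as `‖x‖ → ∞`, for every `z`. -/
def BoundaryCondition (p : E dx → E dz → ℝ) (s : E dx → E dz → E dx) : Prop :=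
  ∀ z, Tendsto (fun x => p x z • s x z) (Bornology.cobounded (E dx)) (𝓝 0)

/-- Well-specification and identifiability of the family of joint densities
`p(x, z; θ) = p(x|z; θ) p(z)`. Distinct parameters have to give distinct distributions, that is,
densities which are not equal almost everywhere. -/
structure Identifiable (Θ : Set (E d)) (θstar : E d) (pM : E d → E dx → E dz → ℝ)
    (p : E dx → E dz → ℝ) (q : E dz → ℝ) : Prop where
  mem : θstar ∈ Θ
  wellSpecified : ∀ x z, jointDensity p q x z = jointDensity (pM θstar) q x z
  identifiable : ∀ θ ∈ Θ, θ ≠ θstar →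
    ¬ (fun w : E dx × E dz => jointDensity (pM θ) q w.1 w.2) =ᵐ[volume]
      (fun w => jointDensity (pM θstar) q w.1 w.2)

/-- Lipschitz continuity in `θ`, in Frobenius norm, of `∇ₓ s` and of `s sᵀ`, with constants
`L₁(x, z)`, `L₂(x, z)` that are square integrable under the law `P` of `(x, z)`. -/
structure LipschitzScore (Θ : Set (E d)) (s : E d → E dx → E dz → E dx)
    (P : Measure (E dx × E dz)) (L₁ L₂ : E dx → E dz → ℝ) : Prop where
  lipschitz_jacobian : ∀ x z, ∀ θ₁ ∈ Θ, ∀ θ₂ ∈ Θ,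
    ‖jacobian (s θ₁) x z - jacobian (s θ₂) x z‖ ≤ L₁ x z * ‖θ₁ - θ₂‖
  lipschitz_outer : ∀ x z, ∀ θ₁ ∈ Θ, ∀ θ₂ ∈ Θ,
    ‖outer (s θ₁ x z) - outer (s θ₂ x z)‖ ≤ L₂ x z * ‖θ₁ - θ₂‖
  memLp_jacobian : MemLp (fun w : E dx × E dz => L₁ w.1 w.2) 2 P
  memLp_outer : MemLp (fun w : E dx × E dz => L₂ w.1 w.2) 2 P

/-- Bounded moments of the projection vectors: `E ‖v vᵀ‖_F² < ∞`. -/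
def BoundedMoments (pv : Measure (E dx)) : Prop :=
  Integrable (fun v : E dx => ‖outer v‖ ^ 2) pv

/-- The Lipschitz constant `L(x, z, v) = (L₁(x, z) + ½ L₂(x, z)) ‖v vᵀ‖_F` of the loss in `θ`. -/
def lossLipschitz (L₁ L₂ : E dx → E dz → ℝ) (x : E dx) (z : E dz) (v : E dx) : ℝ :=
  (L₁ x z + 1 / 2 * L₂ x z) * ‖outer v‖

/-- The standing setting: `p(z)` is a density, the true conditional density `p(x|z)` and all
`p(x|z; θ)`, `θ ∈ Θ`, are conditional densities, and the assumptions of the consistency theorem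
hold. -/
structure Assumptions (Θ : Set (E d)) (θstar : E d) (pM : E d → E dx → E dz → ℝ)
    (p : E dx → E dz → ℝ) (q : E dz → ℝ) (pv : Measure (E dx))
    (L₁ L₂ : E dx → E dz → ℝ) : Prop where
  density : IsDensity q
  condDensity : IsCondDensity p
  condDensity_model : ∀ θ ∈ Θ, IsCondDensity (pM θ)
  isProbabilityMeasure : IsProbabilityMeasure pv
  regularScore : RegularScore p p
  regularScore_model : ∀ θ ∈ Θ, RegularScore p (pM θ)
  regularProjection : RegularProjection pv
  boundary : ∀ θ ∈ Θ, BoundaryCondition p (score (pM θ))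
  identifiable : Identifiable Θ θstar pM p q
  positive : ∀ θ ∈ Θ, ∀ x z, 0 < jointDensity (pM θ) q x z
  compact : IsCompact Θ
  lipschitz : LipschitzScore Θ (fun θ => score (pM θ)) (jointLaw p q) L₁ L₂
  boundedMoments : BoundedMoments pv

/-- The data: the blocks `((xᵢ, zᵢ), (vᵢⱼ)_{j < m})`, `i = 0, 1, …`, are independent, and in each
block `(xᵢ, zᵢ) ∼ P` and `vᵢⱼ ∼ pv` are all independent. -/
structure IsSample {Ω : Type*} [MeasurableSpace Ω] (μ : Measure Ω)
    (P : Measure (E dx × E dz)) (pv : Measure (E dx)) {m : ℕ}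
    (X : ℕ → Ω → E dx) (Z : ℕ → Ω → E dz) (V : ℕ → Fin m → Ω → E dx) : Prop where
  indep : iIndepFun (fun i ω => ((X i ω, Z i ω), fun j => V i j ω)) μ
  hasLaw : ∀ i, HasLaw (fun ω => ((X i ω, Z i ω), fun j => V i j ω))
    (P.prod (Measure.pi fun _ : Fin m => pv)) μ

end CSSM

end

/-! Everything is done with the excess loss over the true parameter, `excess`. It vanishes at
`θstar` and is Lipschitz in `θ` with a square-integrable constant, so it is integrable even when the
loss itself is not.

Identification. For fixed `z` and `v`, integration by parts turns the expected excess loss into half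
the second moment of the projected score difference (`integral_loss_sub_eq`). If the total excess
vanishes, almost every `v` is orthogonal to the score difference, and `E[v vᵀ] ≻ 0` forces the
scores to agree. Equal scores mean that the log-densities differ by a constant, which normalization
makes zero, so identifiability gives `θ = θstar` (`integral_excess_pos`). By compactness the excess
is bounded below away from `θstar`.

Uniform deviations. The `m` projections of one data point share that point, so the independent unit
is the block, over which the loss is averaged. Symmetrization by a ghost sample reduces the centred
process to a Rademacher process with Lipschitz coefficients. Chaining along nets at the scales `R /
2 ^ k`, whose sizes are bounded by volume, gives a factor `√d` and no logarithm
(`sum_abs_rademacher_chaining_le`). The supremum over `Θ` need not be measurable, so the outcome is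
a measurable majorant with a controlled integral (`exists_majorant_empirical_process`).

Conclusion. The majorant gives the rate directly. With Markov's inequality and the separation it
gives consistency, and with the `L¹` law of large numbers at the single parameter `θstar` it gives
uniform convergence. -/

/-! ### Rademacher sums: exponential moments and the finite maximal inequality. -/

/-- The sign `±1` attached to a Boolean. -/
def signOf (b : Bool) : ℝ := if b then 1 else -1

theorem sum_exp_signOf_mul_le (a : ℝ) :
    ∑ b : Bool, Real.exp (signOf b * a) ≤ 2 * Real.exp (a ^ 2 / 2) := by
  have h := Real.cosh_le_exp_half_sq a
  rw [Real.cosh_eq] at h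
  simp only [signOf, Fintype.sum_bool, if_true, one_mul, Bool.false_eq_true, if_false, neg_mul]
  linarith

/-- The exponential moments of a Rademacher sum. -/
theorem sum_exp_rademacher_le {n : ℕ} (a : Fin n → ℝ) :
    ∑ ε : Fin n → Bool, Real.exp (∑ i, signOf (ε i) * a i) ≤
      2 ^ n * Real.exp ((∑ i, a i ^ 2) / 2) := by
  simp only [Real.exp_sum]
  rw [← Fintype.prod_sum (fun i b => Real.exp (signOf b * a i))]
  calc ∏ i, ∑ b : Bool, Real.exp (signOf b * a i)
      ≤ ∏ i : Fin n, 2 * Real.exp (a i ^ 2 / 2) :=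
        Finset.prod_le_prod (fun i _ => Finset.sum_nonneg fun _ _ => (Real.exp_pos _).le)
          fun i _ => sum_exp_signOf_mul_le _
    _ = _ := by
        rw [Finset.prod_mul_distrib, ← Real.exp_sum, Finset.sum_div]
        simp

/-- Since `e^|y| ≤ e^y + e^(-y)`, the absolute value costs only a factor 2, which later reappears as
the 2 in front of the cardinality. -/
theorem sum_exp_abs_rademacher_le {n : ℕ} (a : Fin n → ℝ) :
    ∑ ε : Fin n → Bool, Real.exp |∑ i, signOf (ε i) * a i| ≤
      2 ^ n * (2 * Real.exp ((∑ i, a i ^ 2) / 2)) := by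
  have h1 := sum_exp_rademacher_le a
  have h2 := sum_exp_rademacher_le (fun i => -a i)
  calc ∑ ε : Fin n → Bool, Real.exp |∑ i, signOf (ε i) * a i|
      ≤ ∑ ε : Fin n → Bool, (Real.exp (∑ i, signOf (ε i) * a i) +
          Real.exp (∑ i, signOf (ε i) * -a i)) := by
        refine Finset.sum_le_sum fun ε _ => ?_
        simp only [mul_neg, Finset.sum_neg_distrib]
        rcases abs_cases (∑ i, signOf (ε i) * a i) with h | h <;> rw [h.1]
        · linarith [Real.exp_pos (-∑ i, signOf (ε i) * a i)]
        · linarith [Real.exp_pos (∑ i, signOf (ε i) * a i)]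
    _ ≤ _ := by
        rw [Finset.sum_add_distrib]
        simp only [neg_sq] at h2
        linarith

/-- Maximal inequality for finitely many Rademacher sums; the maximum is replaced by an
arbitrary selection `τ` of an index for each choice of signs. -/
theorem sum_abs_rademacher_selection_le {n : ℕ} {ι : Type*} (T : Finset ι) (a : ι → Fin n → ℝ)
    {s u : ℝ} (hs : 0 ≤ s) (hu : 0 < u) (ha : ∀ t ∈ T, ∑ i, a t i ^ 2 ≤ s ^ 2)
    (hT : 2 * (T.card : ℝ) ≤ Real.exp (u ^ 2 / 2)) (τ : (Fin n → Bool) → ι)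
    (hτ : ∀ ε, τ ε ∈ T) :
    ∑ ε : Fin n → Bool, |∑ i, signOf (ε i) * a (τ ε) i| ≤ 2 ^ n * (s * u) := by
  rcases hs.eq_or_lt with rfl | hs
  · have h0 : ∀ ε i, a (τ ε) i = 0 := by
      intro ε i
      have h1 := ha _ (hτ ε)
      have h2 := Finset.single_le_sum (f := fun i => a (τ ε) i ^ 2)
        (fun i _ => sq_nonneg _) (Finset.mem_univ i)
      have h3 : a (τ ε) i ^ 2 ≤ 0 := by linarith
      exact pow_eq_zero_iff two_ne_zero |>.1 (le_antisymm h3 (sq_nonneg _))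
    simp [h0]
  -- Chernoff parameter: it makes each variance term `l² s²` equal to `u²`.
  set l := u / s with hl
  have hlpos : 0 < l := div_pos hu hs
  -- This tangent-line bound for `exp` at `u²` replaces Jensen's inequality: once the exponentials
  -- average to at most `e^(u²)`, the average of `l * |y|` is at most `u²`.
  have key : ∀ y : ℝ, l * |y| ≤ u ^ 2 - 1 + Real.exp (l * |y|) / Real.exp (u ^ 2) := by
    intro y
    rw [← Real.exp_sub]
    linarith [Real.add_one_le_exp (l * |y| - u ^ 2)]
  have hexp : ∑ ε : Fin n → Bool, Real.exp (l * |∑ i, signOf (ε i) * a (τ ε) i|) ≤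
      2 ^ n * Real.exp (u ^ 2) := by
    calc ∑ ε : Fin n → Bool, Real.exp (l * |∑ i, signOf (ε i) * a (τ ε) i|)
        ≤ ∑ ε : Fin n → Bool, ∑ t ∈ T, Real.exp |∑ i, signOf (ε i) * (l * a t i)| := by
          refine Finset.sum_le_sum fun ε _ => ?_
          have : ∀ t, Real.exp (l * |∑ i, signOf (ε i) * a t i|) =
              Real.exp |∑ i, signOf (ε i) * (l * a t i)| := by
            intro t
            rw [← abs_of_pos hlpos, ← abs_mul, Finset.mul_sum, abs_of_pos hlpos]
            congr 2
            exact Finset.sum_congr rfl fun i _ => by ring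
          rw [this]
          exact Finset.single_le_sum
            (f := fun t => Real.exp |∑ i, signOf (ε i) * (l * a t i)|)
            (fun _ _ => (Real.exp_pos _).le) (hτ ε)
      _ = ∑ t ∈ T, ∑ ε : Fin n → Bool, Real.exp |∑ i, signOf (ε i) * (l * a t i)| :=
          Finset.sum_comm
      _ ≤ ∑ t ∈ T, 2 ^ n * (2 * Real.exp (u ^ 2 / 2)) := by
          refine Finset.sum_le_sum fun t ht => (sum_exp_abs_rademacher_le _).trans ?_
          gcongr
          calc ∑ i, (l * a t i) ^ 2 = l ^ 2 * ∑ i, a t i ^ 2 := by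
                rw [Finset.mul_sum]; exact Finset.sum_congr rfl fun i _ => by ring
            _ ≤ l ^ 2 * s ^ 2 := by gcongr; exact ha t ht
            _ = u ^ 2 := by rw [hl]; field_simp
      _ = 2 ^ n * (2 * (T.card : ℝ) * Real.exp (u ^ 2 / 2)) := by
          rw [Finset.sum_const, nsmul_eq_mul]; ring
      _ ≤ 2 ^ n * (Real.exp (u ^ 2 / 2) * Real.exp (u ^ 2 / 2)) := by gcongr
      _ = _ := by rw [← Real.exp_add]; ring_nf
  have hsum : l * ∑ ε : Fin n → Bool, |∑ i, signOf (ε i) * a (τ ε) i| ≤ 2 ^ n * u ^ 2 := by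
    rw [Finset.mul_sum]
    refine (Finset.sum_le_sum fun ε _ => key _).trans ?_
    rw [Finset.sum_add_distrib, Finset.sum_const, ← Finset.sum_div]
    have : (∑ ε : Fin n → Bool, Real.exp (l * |∑ i, signOf (ε i) * a (τ ε) i|)) /
        Real.exp (u ^ 2) ≤ 2 ^ n := by
      rw [div_le_iff₀ (Real.exp_pos _)]; exact hexp
    simp only [Finset.card_univ, Fintype.card_fun, Fintype.card_bool, Fintype.card_fin,
      nsmul_eq_mul, Nat.cast_pow, Nat.cast_ofNat]
    linarith
  have : u * ∑ ε : Fin n → Bool, |∑ i, signOf (ε i) * a (τ ε) i| ≤ u * (2 ^ n * (s * u)) := by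
    calc u * ∑ ε : Fin n → Bool, |∑ i, signOf (ε i) * a (τ ε) i|
        = s * (l * ∑ ε : Fin n → Bool, |∑ i, signOf (ε i) * a (τ ε) i|) := by
          rw [hl]; field_simp
      _ ≤ s * (2 ^ n * u ^ 2) := by gcongr
      _ = _ := by ring
  exact le_of_mul_le_mul_left this hu

/-! ### Covering numbers by volume comparison. -/

/-- A finite separated subset of a ball has at most exponentially many points. -/
theorem card_le_of_separated_of_mem_closedBall {V : Type*} [NormedAddCommGroup V]
    [NormedSpace ℝ V] [FiniteDimensional ℝ V] (S : Finset V) (x₀ : V) {R r : ℝ} (hR : 0 ≤ R)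
    (hr : 0 < r) (hS : ∀ x ∈ S, dist x x₀ ≤ R) (hsep : ∀ x ∈ S, ∀ y ∈ S, x ≠ y → r ≤ dist x y) :
    (S.card : ℝ) ≤ (1 + 2 * R / r) ^ Module.finrank ℝ V := by
  borelize V
  let μ : Measure V := Measure.addHaar
  set D := Module.finrank ℝ V
  -- The balls of radius `r / 2` about the points are disjoint and all lie in the ball of radius `R
  -- + r / 2` about `x₀`; their Haar volumes are compared.
  have hdisj : Set.PairwiseDisjoint (S : Set V) (fun x => Metric.ball x (r / 2)) := by
    intro x hx y hy hxy
    exact Metric.ball_disjoint_ball (by linarith [hsep x hx y hy hxy])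
  have hsub : (⋃ x ∈ S, Metric.ball x (r / 2)) ⊆ Metric.ball x₀ (R + r / 2) := by
    refine Set.iUnion₂_subset fun x hx => Metric.ball_subset_ball' ?_
    linarith [hS x hx]
  have I : (S.card : ℝ≥0∞) * ENNReal.ofReal ((r / 2) ^ D) * μ (Metric.ball 0 1) ≤
      ENNReal.ofReal ((R + r / 2) ^ D) * μ (Metric.ball 0 1) :=
    calc
      (S.card : ℝ≥0∞) * ENNReal.ofReal ((r / 2) ^ D) * μ (Metric.ball 0 1) =
          μ (⋃ x ∈ S, Metric.ball x (r / 2)) := by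
        rw [measure_biUnion_finset hdisj fun c _ => measurableSet_ball]
        have : ∀ x : V, μ (Metric.ball x (r / 2)) =
            ENNReal.ofReal ((r / 2) ^ D) * μ (Metric.ball 0 1) :=
          fun x => μ.addHaar_ball_of_pos x (by positivity)
        simp only [this, Finset.sum_const, nsmul_eq_mul, mul_assoc]
      _ ≤ μ (Metric.ball x₀ (R + r / 2)) := measure_mono hsub
      _ = _ := μ.addHaar_ball_of_pos x₀ (by positivity)
  have J : (S.card : ℝ≥0∞) * ENNReal.ofReal ((r / 2) ^ D) ≤ ENNReal.ofReal ((R + r / 2) ^ D) :=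
    (ENNReal.mul_le_mul_iff_left (Metric.measure_ball_pos _ _ zero_lt_one).ne'
      measure_ball_lt_top.ne).1 I
  rw [← ENNReal.ofReal_natCast, ← ENNReal.ofReal_mul (by positivity),
    ENNReal.ofReal_le_ofReal_iff (by positivity)] at J
  have hpos : (0 : ℝ) < (r / 2) ^ D := by positivity
  rw [← le_div_iff₀ hpos, ← div_pow] at J
  have h : (R + r / 2) / (r / 2) = 1 + 2 * R / r := by field_simp; ring
  rwa [h] at J

/-- Finite nets of controlled cardinality in bounded sets. -/
theorem exists_finset_net {V : Type*} [NormedAddCommGroup V] [NormedSpace ℝ V]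
    [FiniteDimensional ℝ V] {Θ : Set V} {x₀ : V} {R r : ℝ} (hR : 0 ≤ R) (hr : 0 < r)
    (hΘ : ∀ x ∈ Θ, dist x x₀ ≤ R) :
    ∃ N : Finset V, ↑N ⊆ Θ ∧ (∀ x ∈ Θ, ∃ y ∈ N, dist x y ≤ r) ∧
      (N.card : ℝ) ≤ (1 + 2 * R / r) ^ Module.finrank ℝ V := by
  classical
  -- An `r`-separated subset of largest cardinality is an `r`-net, as a point farther than `r` from
  -- it could be added. The volume bound guarantees that a largest cardinality exists.
  let good : ℕ → Prop := fun k => ∃ S : Finset V, ↑S ⊆ Θ ∧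
    (∀ x ∈ S, ∀ y ∈ S, x ≠ y → r ≤ dist x y) ∧ S.card = k
  have hb : ∀ k, good k → k ≤ ⌊(1 + 2 * R / r) ^ Module.finrank ℝ V⌋₊ := by
    rintro k ⟨S, hS, hsep, rfl⟩
    exact Nat.le_floor (card_le_of_separated_of_mem_closedBall S x₀ hR hr
      (fun x hx => hΘ x (hS hx)) hsep)
  have h0 : good 0 := ⟨∅, by simp, by simp, rfl⟩
  obtain ⟨N, hN, hsep, hcard⟩ := Nat.findGreatest_spec (P := good)
    (Nat.zero_le ⌊(1 + 2 * R / r) ^ Module.finrank ℝ V⌋₊) h0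
  refine ⟨N, hN, fun x hx => ?_, card_le_of_separated_of_mem_closedBall N x₀ hR hr
      (fun x hx => hΘ x (hN hx)) hsep⟩
  by_contra! hcon
  have hxN : x ∉ N := fun h => by simpa using (hr.trans (hcon x h))
  have hgood : good (N.card + 1) := by
    refine ⟨insert x N, ?_, ?_, Finset.card_insert_of_notMem hxN⟩
    · intro y hy
      rcases Finset.mem_insert.1 (Finset.mem_coe.1 hy) with rfl | h
      exacts [hx, hN h]
    · intro y hy z hz hyz
      rcases Finset.mem_insert.1 hy with rfl | hy' <;>
        rcases Finset.mem_insert.1 hz with rfl | hz'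
      · exact absurd rfl hyz
      · exact (hcon z hz').le
      · rw [dist_comm]; exact (hcon y hy').le
      · exact hsep y hy' z hz' hyz
  have := Nat.le_findGreatest (hb _ hgood) hgood
  omega

/-! ### Chaining. -/

/-- Makes `u = (k + 3) √D` admissible in the maximal inequality at level `k`: twice the net size is
at most `2 ^ ((k + 3) D)`, and `k + 3 ≤ (k + 3)² / 2`. -/
theorem two_mul_net_card_le {D k : ℕ} (hD : 1 ≤ D) :
    2 * (1 + 2 * (2 : ℝ) ^ k) ^ D ≤ Real.exp (((k + 3) * √(D : ℝ)) ^ 2 / 2) := by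
  have hk : (1 : ℝ) ≤ 2 ^ k := one_le_pow₀ one_le_two
  calc 2 * (1 + 2 * (2 : ℝ) ^ k) ^ D ≤ 2 ^ D * (1 + 2 * (2 : ℝ) ^ k) ^ D := by
        gcongr; exact le_self_pow₀ one_le_two (by omega)
    _ ≤ 2 ^ D * ((2 : ℝ) ^ (k + 2)) ^ D := by
        gcongr; rw [pow_add]; linarith
    _ = ((2 : ℝ) ^ (k + 3)) ^ D := by rw [← mul_pow]; ring
    _ ≤ ((Real.exp 1) ^ (k + 3)) ^ D := by
        gcongr; linarith [Real.add_one_le_exp (1 : ℝ)]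
    _ = Real.exp ((k + 3) * D) := by
        rw [← Real.exp_nat_mul, ← Real.exp_nat_mul]; congr 1; push_cast; ring
    _ ≤ _ := by
        apply Real.exp_le_exp.2
        rw [mul_pow, Real.sq_sqrt (Nat.cast_nonneg _)]
        have : (0 : ℝ) ≤ (k + 3) * D * (k + 1) := by positivity
        nlinarith

/-- Dudley's chaining bound for Rademacher processes with Lipschitz coefficients, along nets of a
bounded subset of a finite-dimensional normed space. -/
theorem sum_abs_rademacher_chaining_le {V : Type*} [NormedAddCommGroup V] {Θ : Set V} {x₀ : V}
    {R : ℝ} {D : ℕ} (hD : 1 ≤ D) (hR : 0 < R) (hx₀ : x₀ ∈ Θ) (hΘ : ∀ x ∈ Θ, dist x x₀ ≤ R)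
    {N : ℕ → Finset V} (hN : ∀ k, ↑(N k) ⊆ Θ)
    (hnet : ∀ k, ∀ x ∈ Θ, ∃ y ∈ N k, dist x y ≤ R / 2 ^ k)
    (hcard : ∀ k, ((N k).card : ℝ) ≤ (1 + 2 * 2 ^ k) ^ D)
    {n : ℕ} {a : V → Fin n → ℝ} {b : Fin n → ℝ} (ha₀ : ∀ i, a x₀ i = 0)
    (ha : ∀ x ∈ Θ, ∀ y ∈ Θ, ∀ i, |a x i - a y i| ≤ b i * dist x y)
    (k : ℕ) (τ : (Fin n → Bool) → V) (hτ : ∀ ε, τ ε ∈ N k) :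
    ∑ ε : Fin n → Bool, |∑ i, signOf (ε i) * a (τ ε) i| ≤
      2 ^ n * (√(D : ℝ) * R * √(∑ i, b i ^ 2)) * (13 - (2 * k + 10) / 2 ^ k) := by
  have hD' : (0 : ℝ) < √(D : ℝ) := Real.sqrt_pos.2 (by exact_mod_cast hD)
  have hsq : ∀ x ∈ Θ, ∀ y ∈ Θ, ∀ ρ : ℝ, dist x y ≤ ρ →
      ∑ i, (a x i - a y i) ^ 2 ≤ (ρ * √(∑ i, b i ^ 2)) ^ 2 := by
    intro x hx y hy ρ hρ
    rw [mul_pow, Real.sq_sqrt (Finset.sum_nonneg fun _ _ => sq_nonneg _), Finset.mul_sum]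
    refine Finset.sum_le_sum fun i _ => ?_
    calc (a x i - a y i) ^ 2 = |a x i - a y i| ^ 2 := (sq_abs _).symm
      _ ≤ (b i * dist x y) ^ 2 := by gcongr; exact ha x hx y hy i
      _ = dist x y ^ 2 * b i ^ 2 := by ring
      _ ≤ _ := by gcongr
  -- Level 0 contributes `3` and passing from level `k` to `k + 1` contributes `(k + 4) / 2 ^ k`.
  -- These sum to `13`, and `(2 * k + 10) / 2 ^ k` is the remaining tail.
  induction k generalizing τ with
  | zero =>
    have h := sum_abs_rademacher_selection_le (N 0) a (s := R * √(∑ i, b i ^ 2))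
      (u := ((0 : ℕ) + 3) * √(D : ℝ)) (by positivity) (by positivity)
      (fun t ht => by simpa [ha₀] using hsq t (hN 0 ht) x₀ hx₀ R (hΘ t (hN 0 ht)))
      (le_trans (by gcongr; exact hcard 0) (two_mul_net_card_le hD)) τ hτ
    refine h.trans (le_of_eq ?_)
    push_cast; ring
  | succ k ih =>
    -- The link of the chain: each point of the finer net is sent to a point of `N k` within `R / 2
    -- ^ k`. The nets need not be nested.
    choose! π hπN hπ using hnet k
    have h1 := ih (fun ε => π (τ ε)) (fun ε => hπN _ (hN _ (hτ ε)))
    have h2 := sum_abs_rademacher_selection_le (N (k + 1)) (fun t i => a t i - a (π t) i)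
      (s := R / 2 ^ k * √(∑ i, b i ^ 2))
      (u := ((k + 1 : ℕ) + 3) * √(D : ℝ)) (by positivity) (by positivity)
      (fun t ht => hsq t (hN _ ht) (π t) (hN _ (hπN _ (hN _ ht))) _ (hπ _ (hN _ ht)))
      (le_trans (by gcongr; exact hcard (k + 1)) (two_mul_net_card_le hD)) τ hτ
    calc ∑ ε : Fin n → Bool, |∑ i, signOf (ε i) * a (τ ε) i|
        ≤ ∑ ε : Fin n → Bool, (|∑ i, signOf (ε i) * a (π (τ ε)) i| +
            |∑ i, signOf (ε i) * (a (τ ε) i - a (π (τ ε)) i)|) := by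
          refine Finset.sum_le_sum fun ε _ => ?_
          simp only [mul_sub, Finset.sum_sub_distrib]
          refine le_trans (le_of_eq ?_) (abs_add_le _ _)
          congr 1; ring
      _ ≤ _ := by
          rw [Finset.sum_add_distrib]
          refine (add_le_add h1 h2).trans (le_of_eq ?_)
          push_cast; rw [pow_succ]; field_simp; ring

/-! ### Symmetrization by a ghost sample and random signs. -/

section Symmetrization

variable {α ι : Type*} [MeasurableSpace α]

/-- Symmetrization by an independent copy. -/
theorem lintegral_iSup_enorm_sum_sub_integral_le (ν : Measure α) [IsProbabilityMeasure ν] (n : ℕ)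
    (T : Finset ι) {g : ι → α → ℝ} (hg : ∀ t ∈ T, Measurable (g t))
    (hgi : ∀ t ∈ T, Integrable (g t) ν) :
    ∫⁻ w : Fin n → α, ⨆ t ∈ T, ‖∑ i, (g t (w i) - ∫ x, g t x ∂ν)‖ₑ
        ∂(Measure.pi fun _ => ν) ≤
      ∫⁻ u : Fin n → α × α, ⨆ t ∈ T, ‖∑ i, (g t (u i).1 - g t (u i).2)‖ₑ
        ∂(Measure.pi fun _ => ν.prod ν) := by
  have hint : ∀ t ∈ T, ∀ i : Fin n,
      Integrable (fun w : Fin n → α => g t (w i)) (Measure.pi fun _ => ν) := fun t ht i =>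
    (measurePreserving_eval (fun _ : Fin n => ν) i).integrable_comp_of_integrable (hgi t ht)
  have hval : ∀ t ∈ T, ∀ i : Fin n,
      ∫ w : Fin n → α, g t (w i) ∂(Measure.pi fun _ => ν) = ∫ x, g t x ∂ν := fun t ht i => by
    conv_rhs => rw [← (measurePreserving_eval (fun _ : Fin n => ν) i).map_eq]
    rw [integral_map (measurable_pi_apply i).aemeasurable (hg t ht).aestronglyMeasurable]
  let F : (Fin n → α) × (Fin n → α) → ℝ≥0∞ := fun u =>
    ⨆ t ∈ T, ‖∑ i, (g t (u.1 i) - g t (u.2 i))‖ₑ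
  have hF : Measurable F := by
    refine Measurable.biSup _ T.countable_toSet fun t ht => Measurable.enorm ?_
    refine Finset.measurable_sum _ fun i _ => ?_
    have := hg t ht
    fun_prop
  calc ∫⁻ w : Fin n → α, ⨆ t ∈ T, ‖∑ i, (g t (w i) - ∫ x, g t x ∂ν)‖ₑ
        ∂(Measure.pi fun _ => ν)
      ≤ ∫⁻ w : Fin n → α, ∫⁻ w' : Fin n → α, F (w, w')
          ∂(Measure.pi fun _ => ν) ∂(Measure.pi fun _ => ν) := by
        refine lintegral_mono fun w => iSup₂_le fun t ht => ?_
        -- The mean is the integral over the ghost sample `w'`; the norm and the supremum are then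
        -- moved inside that integral.
        have : ∑ i, (g t (w i) - ∫ x, g t x ∂ν) =
            ∫ w' : Fin n → α, ∑ i, (g t (w i) - g t (w' i)) ∂(Measure.pi fun _ => ν) := by
          have hs : ∀ i ∈ (Finset.univ : Finset (Fin n)), Integrable
              (fun w' : Fin n → α => g t (w i) - g t (w' i)) (Measure.pi fun _ => ν) :=
            fun i _ => (integrable_const _).sub (hint t ht i)
          rw [integral_finsetSum _ hs]
          refine Finset.sum_congr rfl fun i _ => ?_
          rw [integral_sub (integrable_const _) (hint t ht i), hval t ht i]
          simp
        rw [this]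
        refine (enorm_integral_le_lintegral_enorm _).trans (lintegral_mono fun w' => ?_)
        exact le_iSup₂_of_le (f := fun t _ => ‖∑ i, (g t (w i) - g t (w' i))‖ₑ) t ht le_rfl
    _ = ∫⁻ u, F u ∂((Measure.pi fun _ => ν).prod (Measure.pi fun _ => ν)) :=
        (lintegral_prod _ hF.aemeasurable).symm
    _ = _ := by
        rw [← (measurePreserving_arrowProdEquivProdArrow α α (Fin n)
          (fun _ => ν) (fun _ => ν)).lintegral_comp hF]
        rfl

/-- Exchanging the two members of the pairs with sign `-1` preserves the product measure and flips
exactly those differences. The identity holds for each fixed sign pattern. -/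
theorem lintegral_iSup_enorm_sum_sub_eq_signs (ν : Measure α) [IsProbabilityMeasure ν] {n : ℕ}
    (T : Finset ι) {g : ι → α → ℝ} (hg : ∀ t ∈ T, Measurable (g t)) (ε : Fin n → Bool) :
    ∫⁻ u : Fin n → α × α, ⨆ t ∈ T, ‖∑ i, (g t (u i).1 - g t (u i).2)‖ₑ
        ∂(Measure.pi fun _ => ν.prod ν) =
      ∫⁻ u : Fin n → α × α, ⨆ t ∈ T, ‖∑ i, signOf (ε i) * (g t (u i).1 - g t (u i).2)‖ₑ
        ∂(Measure.pi fun _ => ν.prod ν) := by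
  have hswap : ∀ b : Bool,
      MeasurePreserving (if b then id else (Prod.swap : α × α → α × α)) (ν.prod ν) (ν.prod ν) := by
    rintro (_ | _)
    · simpa using Measure.measurePreserving_swap
    · simpa using MeasurePreserving.id _
  have hmp := measurePreserving_pi (fun _ : Fin n => ν.prod ν) (fun _ : Fin n => ν.prod ν)
    (fun i => hswap (ε i))
  rw [← hmp.lintegral_comp]
  · refine lintegral_congr fun u => ?_
    refine iSup_congr fun t => iSup_congr fun _ => ?_
    congr 1
    refine Finset.sum_congr rfl fun i _ => ?_
    rcases Bool.eq_false_or_eq_true (ε i) with h | h <;> simp [signOf, h]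
  · refine Measurable.biSup _ T.countable_toSet fun t ht => Measurable.enorm ?_
    refine Finset.measurable_sum _ fun i _ => ?_
    have := hg t ht
    fun_prop

/-- A maximum over a finite set is attained; choosing a maximizer for each `e` gives the selection
for which the chaining bound is stated. -/
theorem sum_iSup_enorm_le_of_selection {κ : Type*} [Fintype κ] (T : Finset ι) (hT : T.Nonempty)
    {Y : κ → ι → ℝ} {B : ℝ} (hB : ∀ τ : κ → ι, (∀ e, τ e ∈ T) → ∑ e, |Y e (τ e)| ≤ B) :
    ∑ e, ⨆ t ∈ T, ‖Y e t‖ₑ ≤ ENNReal.ofReal B := by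
  have h : ∀ e, ∃ t ∈ T, ∀ s ∈ T, |Y e s| ≤ |Y e t| := fun e =>
    T.exists_max_image (fun t => |Y e t|) hT
  choose τ hτ hmax using h
  refine le_trans ?_ (ENNReal.ofReal_le_ofReal (hB τ hτ))
  rw [ENNReal.ofReal_sum_of_nonneg fun _ _ => abs_nonneg _]
  refine Finset.sum_le_sum fun e _ => iSup₂_le fun t ht => ?_
  rw [Real.enorm_eq_ofReal_abs]
  exact ENNReal.ofReal_le_ofReal (hmax e t ht)

/-- Jensen's inequality for the concave square root, with integrability from `√f ≤ f + 1`. -/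
theorem lintegral_ofReal_sqrt_le {β : Type*} [MeasurableSpace β] {ρ : Measure β}
    [IsProbabilityMeasure ρ] {f : β → ℝ} (hf : Integrable f ρ) (h0 : ∀ x, 0 ≤ f x) :
    ∫⁻ x, ENNReal.ofReal (√(f x)) ∂ρ ≤ ENNReal.ofReal (√(∫ x, f x ∂ρ)) := by
  have hsqrt : Integrable (fun x => √(f x)) ρ := by
    refine (hf.add (integrable_const (1 : ℝ))).mono'
      (Real.continuous_sqrt.comp_aestronglyMeasurable hf.1) (ae_of_all _ fun x => ?_)
    rw [Real.norm_of_nonneg (Real.sqrt_nonneg _)]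
    simp only [Pi.add_apply]
    nlinarith [Real.sq_sqrt (h0 x), sq_nonneg (√(f x) - 1), Real.sqrt_nonneg (f x)]
  rw [← ofReal_integral_eq_lintegral_ofReal hsqrt (ae_of_all _ fun _ => Real.sqrt_nonneg _)]
  refine ENNReal.ofReal_le_ofReal ?_
  exact Real.strictConcaveOn_sqrt.concaveOn.le_map_integral
    Real.continuous_sqrt.continuousOn isClosed_Ici (ae_of_all _ h0) hf hsqrt

end Symmetrization

/-! ### Uniform deviation bound for Lipschitz empirical processes. -/

section UniformBound

variable {α V : Type*} [MeasurableSpace α] [NormedAddCommGroup V]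

/-- The chaining bound for the centred empirical process over a finite net. -/
theorem lintegral_iSup_net_le {Θ : Set V} {x₀ : V}
    {R : ℝ} {D : ℕ} (hD : 1 ≤ D) (hR : 0 < R) (hx₀ : x₀ ∈ Θ) (hΘ : ∀ x ∈ Θ, dist x x₀ ≤ R)
    {N : ℕ → Finset V} (hN : ∀ k, ↑(N k) ⊆ Θ)
    (hnet : ∀ k, ∀ x ∈ Θ, ∃ y ∈ N k, dist x y ≤ R / 2 ^ k)
    (hcard : ∀ k, ((N k).card : ℝ) ≤ (1 + 2 * 2 ^ k) ^ D)
    (ν : Measure α) [IsProbabilityMeasure ν] (n : ℕ) {g : V → α → ℝ} {l : α → ℝ}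
    (hg : ∀ t ∈ Θ, Measurable (g t)) (hgi : ∀ t ∈ Θ, Integrable (g t) ν)
    (hg₀ : ∀ w, g x₀ w = 0) (hl : MemLp l 2 ν)
    (hgl : ∀ x ∈ Θ, ∀ y ∈ Θ, ∀ w, |g x w - g y w| ≤ l w * dist x y) (k : ℕ) :
    ∫⁻ w : Fin n → α, ⨆ t ∈ N k, ‖∑ i, (g t (w i) - ∫ x, g t x ∂ν)‖ₑ
        ∂(Measure.pi fun _ => ν) ≤
      ENNReal.ofReal (13 * (√(D : ℝ) * R * √(4 * n * ∫ w, l w ^ 2 ∂ν))) := by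
  set ρ : Measure (Fin n → α × α) := Measure.pi fun _ => ν.prod ν
  have hNne : (N k).Nonempty := let ⟨y, hy, _⟩ := hnet k x₀ hx₀; ⟨y, hy⟩
  let f : (Fin n → α × α) → ℝ := fun u => ∑ i, (l (u i).1 + l (u i).2) ^ 2
  have hl1 : MemLp (fun z : α × α => l z.1) 2 (ν.prod ν) :=
    hl.comp_measurePreserving measurePreserving_fst
  have hl2 : MemLp (fun z : α × α => l z.2) 2 (ν.prod ν) :=
    hl.comp_measurePreserving measurePreserving_snd
  have hll : Integrable (fun z : α × α => (l z.1 + l z.2) ^ 2) (ν.prod ν) :=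
    (hl1.add hl2).integrable_sq
  have hfi : ∀ i : Fin n, Integrable (fun u : Fin n → α × α => (l (u i).1 + l (u i).2) ^ 2) ρ :=
    fun i =>
      (measurePreserving_eval (fun _ : Fin n => ν.prod ν) i).integrable_comp_of_integrable hll
  have hf : Integrable f ρ := integrable_finsetSum _ fun i _ => hfi i
  -- The symmetrized coefficients have Lipschitz constant `l z.1 + l z.2`. Its second moment costs a
  -- factor 4, whose root doubles the chaining constant 13 to 26.
  have hpair : ∫ z : α × α, (l z.1 + l z.2) ^ 2 ∂(ν.prod ν) ≤ 4 * ∫ w, l w ^ 2 ∂ν := by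
    have e1 : ∫ z : α × α, l z.1 ^ 2 ∂(ν.prod ν) = ∫ w, l w ^ 2 ∂ν := by
      simpa using integral_fun_fst (μ := ν) (ν := ν) (fun w => l w ^ 2)
    have e2 : ∫ z : α × α, l z.2 ^ 2 ∂(ν.prod ν) = ∫ w, l w ^ 2 ∂ν := by
      simpa using integral_fun_snd (μ := ν) (ν := ν) (fun w => l w ^ 2)
    calc ∫ z : α × α, (l z.1 + l z.2) ^ 2 ∂(ν.prod ν)
        ≤ ∫ z : α × α, (2 * l z.1 ^ 2 + 2 * l z.2 ^ 2) ∂(ν.prod ν) := by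
          refine integral_mono hll
            ((hl1.integrable_sq.const_mul 2).add (hl2.integrable_sq.const_mul 2)) fun z => ?_
          nlinarith [sq_nonneg (l z.1 - l z.2)]
      _ = _ := by
          rw [integral_add (hl1.integrable_sq.const_mul 2) (hl2.integrable_sq.const_mul 2),
            integral_const_mul, integral_const_mul, e1, e2]
          ring
  have hfint : ∫ u, f u ∂ρ ≤ 4 * n * ∫ w, l w ^ 2 ∂ν := by
    rw [integral_finsetSum _ fun i _ => hfi i]
    have : ∀ i : Fin n, ∫ u : Fin n → α × α, (l (u i).1 + l (u i).2) ^ 2 ∂ρ =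
        ∫ z : α × α, (l z.1 + l z.2) ^ 2 ∂(ν.prod ν) := fun i => by
      have hm := measurePreserving_eval (fun _ : Fin n => ν.prod ν) i
      conv_rhs => rw [← hm.map_eq]
      rw [integral_map hm.aemeasurable (by rw [hm.map_eq]; exact hll.1)]
    simp only [this, Finset.sum_const, Finset.card_univ, Fintype.card_fin, nsmul_eq_mul]
    calc (n : ℝ) * _ ≤ n * (4 * ∫ w, l w ^ 2 ∂ν) := by gcongr
      _ = _ := by ring
  have hpt : ∀ u : Fin n → α × α,
      ∑ ε : Fin n → Bool, ⨆ t ∈ N k, ‖∑ i, signOf (ε i) * (g t (u i).1 - g t (u i).2)‖ₑ ≤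
        ENNReal.ofReal (2 ^ n * (13 * (√(D : ℝ) * R))) * ENNReal.ofReal (√(f u)) := by
    intro u
    rw [← ENNReal.ofReal_mul (by positivity)]
    refine sum_iSup_enorm_le_of_selection (N k) hNne fun τ hτ => ?_
    refine (sum_abs_rademacher_chaining_le hD hR hx₀ hΘ hN hnet hcard
      (a := fun t i => g t (u i).1 - g t (u i).2) (b := fun i => l (u i).1 + l (u i).2)
      (by simp [hg₀]) (fun x hx y hy i => ?_) k τ hτ).trans ?_
    · calc |g x (u i).1 - g x (u i).2 - (g y (u i).1 - g y (u i).2)|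
          = |(g x (u i).1 - g y (u i).1) - (g x (u i).2 - g y (u i).2)| := by congr 1; ring
        _ ≤ |g x (u i).1 - g y (u i).1| + |g x (u i).2 - g y (u i).2| := abs_sub _ _
        _ ≤ l (u i).1 * dist x y + l (u i).2 * dist x y :=
            add_le_add (hgl x hx y hy _) (hgl x hx y hy _)
        _ = _ := by ring
    · have : (0 : ℝ) ≤ (2 * k + 10) / 2 ^ k := by positivity
      calc 2 ^ n * (√(D : ℝ) * R * √(f u)) * (13 - (2 * k + 10) / 2 ^ k)
          ≤ 2 ^ n * (√(D : ℝ) * R * √(f u)) * 13 := by gcongr; linarith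
        _ = _ := by ring
  -- All `2 ^ n` sign patterns give the same integral, so the multiplied integral is a sum over
  -- signs to which the pointwise chaining bound applies; the factor is cancelled at the end.
  have hmain : (2 : ℝ≥0∞) ^ n * ∫⁻ w : Fin n → α, ⨆ t ∈ N k, ‖∑ i, (g t (w i) - ∫ x, g t x ∂ν)‖ₑ
        ∂(Measure.pi fun _ => ν) ≤
      2 ^ n * ENNReal.ofReal (13 * (√(D : ℝ) * R * √(4 * n * ∫ w, l w ^ 2 ∂ν))) := by
    have hgN : ∀ t ∈ N k, Measurable (g t) := fun t ht => hg t (hN k ht)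
    calc (2 : ℝ≥0∞) ^ n * ∫⁻ w : Fin n → α, ⨆ t ∈ N k, ‖∑ i, (g t (w i) - ∫ x, g t x ∂ν)‖ₑ
          ∂(Measure.pi fun _ => ν)
        ≤ 2 ^ n * ∫⁻ u, ⨆ t ∈ N k, ‖∑ i, (g t (u i).1 - g t (u i).2)‖ₑ ∂ρ := by
          gcongr
          exact lintegral_iSup_enorm_sum_sub_integral_le ν n (N k) hgN
            (fun t ht => hgi t (hN k ht))
      _ = ∑ ε : Fin n → Bool,
            ∫⁻ u, ⨆ t ∈ N k, ‖∑ i, signOf (ε i) * (g t (u i).1 - g t (u i).2)‖ₑ ∂ρ := by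
          rw [Finset.sum_congr rfl fun ε _ =>
            (lintegral_iSup_enorm_sum_sub_eq_signs ν (N k) hgN ε).symm]
          simp [ρ]
      _ = ∫⁻ u, ∑ ε : Fin n → Bool,
            ⨆ t ∈ N k, ‖∑ i, signOf (ε i) * (g t (u i).1 - g t (u i).2)‖ₑ ∂ρ := by
          rw [lintegral_finsetSum]
          intro ε _
          refine Measurable.biSup _ (N k).countable_toSet fun t ht => Measurable.enorm ?_
          refine Finset.measurable_sum _ fun i _ => ?_
          have := hgN t ht
          fun_prop
      _ ≤ ∫⁻ u, ENNReal.ofReal (2 ^ n * (13 * (√(D : ℝ) * R))) * ENNReal.ofReal (√(f u)) ∂ρ :=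
          lintegral_mono hpt
      _ = ENNReal.ofReal (2 ^ n * (13 * (√(D : ℝ) * R))) * ∫⁻ u, ENNReal.ofReal (√(f u)) ∂ρ :=
          lintegral_const_mul' _ _ ENNReal.ofReal_ne_top
      _ ≤ ENNReal.ofReal (2 ^ n * (13 * (√(D : ℝ) * R))) *
            ENNReal.ofReal (√(4 * n * ∫ w, l w ^ 2 ∂ν)) := by
          gcongr
          refine (lintegral_ofReal_sqrt_le hf fun u => Finset.sum_nonneg fun _ _ => sq_nonneg _).trans
            (ENNReal.ofReal_le_ofReal (Real.sqrt_le_sqrt hfint))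
      _ = _ := by
          rw [← ENNReal.ofReal_mul (by positivity), mul_assoc,
            ENNReal.ofReal_mul (by positivity)]
          congr 1
          · rw [ENNReal.ofReal_pow (by norm_num)]; simp
          · congr 1; ring
  exact (ENNReal.mul_le_mul_iff_right (by positivity) (by simp)).1 hmain

/-- Uniform law of large numbers with rate for a process which is Lipschitz in a parameter of a
bounded set of a finite-dimensional space. -/
theorem exists_majorant_empirical_process [NormedSpace ℝ V] [FiniteDimensional ℝ V] {Θ : Set V}
    {x₀ : V} (hb : Bornology.IsBounded Θ) (hx₀ : x₀ ∈ Θ)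
    (ν : Measure α) [IsProbabilityMeasure ν] {g : V → α → ℝ} {l : α → ℝ}
    (hg : ∀ t ∈ Θ, Measurable (g t)) (hgi : ∀ t ∈ Θ, Integrable (g t) ν)
    (hg₀ : ∀ w, g x₀ w = 0) (hl : MemLp l 2 ν)
    (hgl : ∀ x ∈ Θ, ∀ y ∈ Θ, ∀ w, |g x w - g y w| ≤ l w * dist x y)
    {Ω : Type*} [MeasurableSpace Ω] {μ : Measure Ω} [IsProbabilityMeasure μ] {W : ℕ → Ω → α}
    (hind : iIndepFun W μ) (hlaw : ∀ i, HasLaw (W i) ν μ) {n : ℕ} (hn : 0 < n) :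
    ∃ H : Ω → ℝ≥0∞, AEMeasurable H μ ∧
      (∀ ω, ∀ t ∈ Θ, ‖(n : ℝ)⁻¹ * ∑ i ∈ Finset.range n, g t (W i ω) - ∫ w, g t w ∂ν‖ₑ ≤ H ω) ∧
      ∫⁻ ω, H ω ∂μ ≤ ENNReal.ofReal (26 * Metric.diam Θ *
        √((Module.finrank ℝ V : ℝ) / n) * √(∫ w, l w ^ 2 ∂ν)) := by
  -- Only `x₀` remains, where the process is zero. Otherwise the diameter and the dimension are
  -- positive, as chaining requires.
  by_cases hsub : Θ.Subsingleton
  · refine ⟨0, aemeasurable_const, fun ω t ht => ?_, by simp⟩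
    rw [hsub ht hx₀]
    simp [hg₀]
  set R := Metric.diam Θ with hRdef
  set D := Module.finrank ℝ V with hDdef
  have hΘ : ∀ x ∈ Θ, ∀ y ∈ Θ, dist x y ≤ R := fun x hx y hy => Metric.dist_le_diam_of_mem hb hx hy
  have hR : 0 < R := Metric.diam_pos (Set.not_subsingleton_iff.1 hsub) hb
  have hD : 1 ≤ D := by
    by_contra h
    have : Subsingleton V := Module.finrank_zero_iff.1 (by omega : Module.finrank ℝ V = 0)
    exact hsub Set.subsingleton_of_subsingleton
  have hnets := fun k : ℕ => exists_finset_net (Θ := Θ) (x₀ := x₀) (R := R) (r := R / 2 ^ k)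
    hR.le (by positivity) (fun x hx => hΘ x hx x₀ hx₀)
  choose N hN hnet hcard using hnets
  replace hcard : ∀ k, ((N k).card : ℝ) ≤ (1 + 2 * 2 ^ k) ^ D := fun k => by
    convert hcard k using 3
    field_simp
  have hn' : (0 : ℝ) < n := by exact_mod_cast hn
  let G : V → Ω → ℝ := fun t ω =>
    (n : ℝ)⁻¹ * ∑ i ∈ Finset.range n, g t (W i ω) - ∫ w, g t w ∂ν
  have hGm : ∀ t ∈ Θ, AEMeasurable (G t) μ := fun t ht =>
    ((Finset.aemeasurable_fun_sum _ fun i _ =>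
      (hg t ht).comp_aemeasurable (hlaw i).aemeasurable).const_mul _).sub_const _
  have hSm : ∀ k, AEMeasurable (fun ω => ⨆ t ∈ N k, ‖G t ω‖ₑ) μ := fun k =>
    AEMeasurable.biSup _ (N k).countable_toSet fun t ht => (hGm t (hN k ht)).enorm
  have hGlip : ∀ ω, ∃ B : ℝ, ∀ x ∈ Θ, ∀ y ∈ Θ, |G x ω - G y ω| ≤ B * dist x y := by
    intro ω
    refine ⟨(n : ℝ)⁻¹ * ∑ i ∈ Finset.range n, l (W i ω) + ∫ w, l w ∂ν, fun x hx y hy => ?_⟩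
    have hli : Integrable l ν := hl.integrable one_le_two
    calc |G x ω - G y ω|
        = |(n : ℝ)⁻¹ * ∑ i ∈ Finset.range n, (g x (W i ω) - g y (W i ω)) -
            ∫ w, (g x w - g y w) ∂ν| := by
          simp only [G]
          rw [integral_sub (hgi x hx) (hgi y hy), Finset.sum_sub_distrib]; congr 1; ring
      _ ≤ |(n : ℝ)⁻¹ * ∑ i ∈ Finset.range n, (g x (W i ω) - g y (W i ω))| +
            |∫ w, (g x w - g y w) ∂ν| := abs_sub _ _
      _ ≤ (n : ℝ)⁻¹ * ∑ i ∈ Finset.range n, l (W i ω) * dist x y + ∫ w, l w * dist x y ∂ν := by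
          rw [abs_mul, abs_of_pos (by positivity : (0 : ℝ) < (n : ℝ)⁻¹)]
          gcongr
          · exact (Finset.abs_sum_le_sum_abs _ _).trans
              (Finset.sum_le_sum fun i _ => hgl x hx y hy _)
          · exact (abs_integral_le_integral_abs).trans
              (integral_mono ((hgi x hx).sub (hgi y hy)).abs (hli.mul_const _)
                fun w => hgl x hx y hy w)
      _ = _ := by rw [← Finset.sum_mul, integral_mul_const]; ring
  -- The majorant is a lower limit of maxima over finite nets: it is a.e. measurable, pathwise
  -- Lipschitz continuity makes it dominate the process on all of `Θ`, and Fatou's lemma carries the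
  -- bound, which is uniform in `k`, to its integral.
  refine ⟨fun ω => liminf (fun k => ⨆ t ∈ N k, ‖G t ω‖ₑ) atTop, ?_, ?_, ?_⟩
  · refine ⟨fun ω => liminf (fun k => (hSm k).mk _ ω) atTop,
      Measurable.liminf fun k => (hSm k).measurable_mk, ?_⟩
    filter_upwards [ae_all_iff.2 fun k => (hSm k).ae_eq_mk] with ω hω
    simp only [hω]
  · intro ω t ht
    obtain ⟨B, hB⟩ := hGlip ω
    have hlim : Tendsto (fun k : ℕ => ENNReal.ofReal (|G t ω| - |B| * (R / 2 ^ k))) atTop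
        (𝓝 (ENNReal.ofReal |G t ω|)) := by
      refine ENNReal.tendsto_ofReal ?_
      have h2 : Tendsto (fun k : ℕ => R / 2 ^ k) atTop (𝓝 0) :=
        tendsto_const_nhds.div_atTop (tendsto_pow_atTop_atTop_of_one_lt one_lt_two)
      simpa using tendsto_const_nhds.sub (h2.const_mul |B|)
    change ‖G t ω‖ₑ ≤ _
    rw [Real.enorm_eq_ofReal_abs, ← hlim.liminf_eq]
    refine liminf_le_liminf (Eventually.of_forall fun k => ?_)
    obtain ⟨y, hy, hty⟩ := hnet k t ht
    refine le_iSup₂_of_le (f := fun t _ => ‖G t ω‖ₑ) y hy ?_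
    rw [Real.enorm_eq_ofReal_abs]
    refine ENNReal.ofReal_le_ofReal ?_
    have h1 := hB t ht y (hN k hy)
    have h3 : B * dist t y ≤ |B| * (R / 2 ^ k) := by
      gcongr; exact le_abs_self B
    linarith [abs_sub_abs_le_abs_sub (G t ω) (G y ω)]
  · refine (lintegral_liminf_le' hSm).trans ?_
    refine liminf_le_of_frequently_le' (Frequently.of_forall fun k => ?_)
    have hW : HasLaw (fun ω (i : Fin n) => W i ω) (Measure.pi fun _ : Fin n => ν) μ := by
      refine ⟨aemeasurable_pi_lambda _ fun i => (hlaw i).aemeasurable, ?_⟩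
      have := (iIndepFun_iff_map_fun_eq_pi_map (μ := μ) (f := fun (i : Fin n) => W i)
        fun i => (hlaw i).aemeasurable).1 (hind.precomp Fin.val_injective)
      rw [this]
      congr 1 with i
      rw [(hlaw i).map_eq]
    have hnet_le := lintegral_iSup_net_le hD hR hx₀ (fun x hx => hΘ x hx x₀ hx₀) hN hnet hcard
      ν n hg hgi hg₀ hl hgl k
    have hGeq : ∀ t ω, ‖G t ω‖ₑ = ENNReal.ofReal ((n : ℝ)⁻¹) *
        ‖∑ i : Fin n, (g t (W i ω) - ∫ x, g t x ∂ν)‖ₑ := fun t ω => by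
      rw [← Real.enorm_of_nonneg (by positivity : (0 : ℝ) ≤ (n : ℝ)⁻¹), ← enorm_mul]
      congr 1
      simp only [G, Finset.sum_range, Finset.sum_sub_distrib, Finset.sum_const, Finset.card_univ,
        Fintype.card_fin, nsmul_eq_mul]
      field_simp
    simp only [hGeq, ← ENNReal.mul_iSup]
    rw [lintegral_const_mul' _ _ ENNReal.ofReal_ne_top]
    have hmeas : Measurable fun w : Fin n → α =>
        ⨆ t ∈ N k, ‖∑ i : Fin n, (g t (w i) - ∫ x, g t x ∂ν)‖ₑ := by
      refine Measurable.biSup _ (N k).countable_toSet fun t ht => Measurable.enorm ?_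
      refine Finset.measurable_sum _ fun i _ => ?_
      have := hg t (hN k ht)
      fun_prop
    have heq : ∫⁻ ω, ⨆ t ∈ N k, ‖∑ i : Fin n, (g t (W i ω) - ∫ x, g t x ∂ν)‖ₑ ∂μ =
        ∫⁻ w : Fin n → α, ⨆ t ∈ N k, ‖∑ i : Fin n, (g t (w i) - ∫ x, g t x ∂ν)‖ₑ
          ∂(Measure.pi fun _ => ν) := by
      rw [← hW.map_eq, lintegral_map' hmeas.aemeasurable hW.aemeasurable]
    rw [heq]
    refine (mul_le_mul_right hnet_le _).trans ?_
    rw [← ENNReal.ofReal_mul (by positivity)]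
    refine ENNReal.ofReal_le_ofReal (le_of_eq ?_)
    have h4 : √(4 * n * ∫ w, l w ^ 2 ∂ν) = 2 * √(n : ℝ) * √(∫ w, l w ^ 2 ∂ν) := by
      rw [Real.sqrt_mul (by positivity), Real.sqrt_mul (by norm_num)]
      congr 2
      rw [show (4 : ℝ) = 2 ^ 2 by norm_num, Real.sqrt_sq (by norm_num)]
    rw [h4, Real.sqrt_div (by positivity)]
    have hsn : (n : ℝ) = √(n : ℝ) * √(n : ℝ) := (Real.mul_self_sqrt hn'.le).symm
    have hspos : 0 < √(n : ℝ) := Real.sqrt_pos.2 hn'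
    rw [show (n : ℝ)⁻¹ = (√(n : ℝ) * √(n : ℝ))⁻¹ by rw [← hsn]]
    field_simp
    ring

end UniformBound

noncomputable section

namespace CSSM

open scoped Matrix Matrix.Norms.Frobenius

variable {dx dz d m : ℕ}

/-! ### Algebra and measurability of the loss -/

theorem norm_matrix_eq_sqrt (M : Matrix (Fin dx) (Fin dx) ℝ) :
    ‖M‖ = √(∑ c : Fin dx × Fin dx, M c.1 c.2 ^ 2) := by
  rw [Matrix.frobenius_norm_def, Real.sqrt_eq_rpow, Fintype.sum_prod_type]
  simp

theorem dotProduct_mulVec_eq_sum (M : Matrix (Fin dx) (Fin dx) ℝ) (v : E dx) :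
    v.ofLp ⬝ᵥ (M *ᵥ v.ofLp) = ∑ c : Fin dx × Fin dx, M c.1 c.2 * outer v c.1 c.2 := by
  simp only [dotProduct, Matrix.mulVec, Fintype.sum_prod_type, outer, Matrix.vecMulVec_apply,
    Finset.mul_sum]
  exact Finset.sum_congr rfl fun i _ => Finset.sum_congr rfl fun j _ => by ring

/-- Cauchy–Schwarz for the Frobenius pairing of `M` with `v vᵀ`. -/
theorem abs_dotProduct_mulVec_le (M : Matrix (Fin dx) (Fin dx) ℝ) (v : E dx) :
    |v.ofLp ⬝ᵥ (M *ᵥ v.ofLp)| ≤ ‖M‖ * ‖outer v‖ := by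
  rw [dotProduct_mulVec_eq_sum, norm_matrix_eq_sqrt, norm_matrix_eq_sqrt, abs_le]
  refine ⟨?_, Real.sum_mul_le_sqrt_mul_sqrt _ _ _⟩
  have := Real.sum_mul_le_sqrt_mul_sqrt Finset.univ
    (fun c : Fin dx × Fin dx => -M c.1 c.2) (fun c => outer v c.1 c.2)
  simp only [neg_mul, Finset.sum_neg_distrib, neg_sq] at this
  linarith

theorem dotProduct_outer_mulVec (s v : E dx) :
    v.ofLp ⬝ᵥ (outer s *ᵥ v.ofLp) = (v.ofLp ⬝ᵥ s.ofLp) ^ 2 := by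
  rw [dotProduct_mulVec_eq_sum, sq, dotProduct, Finset.sum_mul_sum, Fintype.sum_prod_type]
  simp only [outer, Matrix.vecMulVec_apply]
  exact Finset.sum_congr rfl fun i _ => Finset.sum_congr rfl fun j _ => by ring

theorem jacobian_mulVec (s : E dx → E dz → E dx) (x : E dx) (z : E dz) (v : E dx) :
    jacobian s x z *ᵥ v.ofLp = (fderiv ℝ (fun x' => s x' z) x v).ofLp := by
  ext i
  have hv : v = ∑ j, v.ofLp j • EuclideanSpace.single j (1 : ℝ) := by
    ext k; simp [Finset.sum_apply, Pi.single_apply]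
  conv_rhs => rw [hv, map_sum]
  simp only [Matrix.mulVec, dotProduct, jacobian, Matrix.of_apply, map_smul, WithLp.ofLp_sum,
    Finset.sum_apply, WithLp.ofLp_smul, Pi.smul_apply, smul_eq_mul]
  exact Finset.sum_congr rfl fun j _ => mul_comm _ _

theorem loss_eq_inner (s : E dx → E dz → E dx) (x : E dx) (z : E dz) (v : E dx) :
    loss s x z v = inner ℝ v (fderiv ℝ (fun x' => s x' z) x v) + 1 / 2 * inner ℝ v (s x z) ^ 2 := by
  rw [loss, jacobian_mulVec]
  simp [EuclideanSpace.inner_eq_star_dotProduct, dotProduct_comm]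

/-- Both terms of the loss are linear in `v vᵀ`, since `(vᵀ s)² = vᵀ (s sᵀ) v`; this is why the
Lipschitz assumption concerns `s sᵀ`. -/
theorem abs_loss_sub_le (s₁ s₂ : E dx → E dz → E dx) (x : E dx) (z : E dz) (v : E dx) :
    |loss s₁ x z v - loss s₂ x z v| ≤
      (‖jacobian s₁ x z - jacobian s₂ x z‖ + 1 / 2 * ‖outer (s₁ x z) - outer (s₂ x z)‖) *
        ‖outer v‖ := by
  have h : loss s₁ x z v - loss s₂ x z v =
      v.ofLp ⬝ᵥ ((jacobian s₁ x z - jacobian s₂ x z) *ᵥ v.ofLp) +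
        1 / 2 * v.ofLp ⬝ᵥ ((outer (s₁ x z) - outer (s₂ x z)) *ᵥ v.ofLp) := by
    simp only [loss, Matrix.sub_mulVec, dotProduct_sub, dotProduct_outer_mulVec]; ring
  rw [h]
  refine (abs_add_le _ _).trans ?_
  rw [abs_mul, abs_of_pos (by norm_num : (0 : ℝ) < 1 / 2), add_mul, mul_assoc]
  gcongr <;> exact abs_dotProduct_mulVec_le _ _

theorem LipschitzScore.abs_loss_sub_le {Θ : Set (E d)} {s : E d → E dx → E dz → E dx}
    {P : Measure (E dx × E dz)} {L₁ L₂ : E dx → E dz → ℝ} (h : LipschitzScore Θ s P L₁ L₂)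
    {θ₁ θ₂ : E d} (h₁ : θ₁ ∈ Θ) (h₂ : θ₂ ∈ Θ) (x : E dx) (z : E dz) (v : E dx) :
    |loss (s θ₁) x z v - loss (s θ₂) x z v| ≤ lossLipschitz L₁ L₂ x z v * dist θ₁ θ₂ := by
  refine (CSSM.abs_loss_sub_le _ _ x z v).trans ?_
  rw [dist_eq_norm, lossLipschitz, mul_right_comm]
  gcongr
  rw [add_mul, mul_assoc]
  gcongr
  exacts [h.lipschitz_jacobian x z θ₁ h₁ θ₂ h₂, h.lipschitz_outer x z θ₁ h₁ θ₂ h₂]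

theorem measurable_norm_outer : Measurable fun v : E dx => ‖outer v‖ := by
  simp only [norm_matrix_eq_sqrt, outer, Matrix.vecMulVec_apply]
  fun_prop

/-- The square factors into a function of `(x, z)` and a function of `v`, each integrable, and these
variables are independent. -/
theorem memLp_lossLipschitz {Θ : Set (E d)} {s : E d → E dx → E dz → E dx}
    {P : Measure (E dx × E dz)} [IsProbabilityMeasure P] {L₁ L₂ : E dx → E dz → ℝ}
    {pv : Measure (E dx)} [IsProbabilityMeasure pv] (h : LipschitzScore Θ s P L₁ L₂)
    (hb : BoundedMoments pv) :
    MemLp (fun w : (E dx × E dz) × E dx => lossLipschitz L₁ L₂ w.1.1 w.1.2 w.2) 2 (P.prod pv) := by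
  have h1 : MemLp (fun w : E dx × E dz => L₁ w.1 w.2 + 1 / 2 * L₂ w.1 w.2) 2 P :=
    h.memLp_jacobian.add (h.memLp_outer.const_mul _)
  have h2 : MemLp (fun v : E dx => ‖outer v‖) 2 pv :=
    (memLp_two_iff_integrable_sq measurable_norm_outer.aestronglyMeasurable).2 hb
  refine (memLp_two_iff_integrable_sq ?_).2 ?_
  · exact h1.1.comp_fst.mul h2.1.comp_snd
  · simp only [lossLipschitz, mul_pow]
    exact h1.integrable_sq.mul_prod h2.integrable_sq

/-- The dependence on `z` is only measurable, so joint measurability comes from writing the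
derivative as a pointwise limit of difference quotients with steps `1 / (k + 1)`. -/
theorem measurable_fderiv_section {G : Type*} [NormedAddCommGroup G] [NormedSpace ℝ G]
    [MeasurableSpace G] [BorelSpace G] [SecondCountableTopology G] {F : E dx → E dz → G}
    (hF : Measurable (Function.uncurry F)) (hd : ∀ z, Differentiable ℝ fun x => F x z) (v : E dx) :
    Measurable fun w : E dx × E dz => fderiv ℝ (fun x => F x w.2) w.1 v := by
  have hlim : ∀ w : E dx × E dz, Tendsto
      (fun k : ℕ => ((k : ℝ) + 1) • (F (w.1 + ((k : ℝ) + 1)⁻¹ • v) w.2 - F w.1 w.2)) atTop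
      (𝓝 (fderiv ℝ (fun x => F x w.2) w.1 v)) := by
    intro w
    refine ((hd w.2).differentiableAt (x := w.1)).hasFDerivAt.lim v
      (c := fun k : ℕ => (k : ℝ) + 1) ?_
    refine tendsto_norm_atTop_atTop.comp ?_
    exact tendsto_atTop_add_const_right _ _ tendsto_natCast_atTop_atTop
  refine measurable_of_tendsto_metrizable (fun k => ?_) (tendsto_pi_nhds.2 hlim)
  have h1 : Measurable fun w : E dx × E dz => F (w.1 + ((k : ℝ) + 1)⁻¹ • v) w.2 :=
    hF.comp (by fun_prop : Measurable fun w : E dx × E dz => (w.1 + ((k : ℝ) + 1)⁻¹ • v, w.2))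
  exact (h1.sub hF).const_smul _

theorem measurable_score {p : E dx → E dz → ℝ} (hp : Measurable (Function.uncurry p))
    (hd : ∀ z, Differentiable ℝ fun x => Real.log (p x z)) :
    Measurable (Function.uncurry (score p)) := by
  have : Function.uncurry (score p) = fun w => WithLp.toLp 2 fun i =>
      fderiv ℝ (fun x => Real.log (p x w.2)) w.1 (EuclideanSpace.single i 1) := by
    ext w i
    change (score p w.1 w.2).ofLp i =
      fderiv ℝ (fun x => Real.log (p x w.2)) w.1 (EuclideanSpace.single i 1)
    rw [← inner_gradient_left, EuclideanSpace.inner_single_right]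
    simp [score]
  rw [this]
  refine (WithLp.measurable_toLp 2 _).comp (measurable_pi_lambda _ fun i => ?_)
  exact measurable_fderiv_section (F := fun x z => Real.log (p x z)) hp.log hd _

theorem measurable_loss {s : E dx → E dz → E dx} (hs : Measurable (Function.uncurry s))
    (hd : ∀ z, Differentiable ℝ fun x => s x z) :
    Measurable fun w : (E dx × E dz) × E dx => loss s w.1.1 w.1.2 w.2 := by
  have hJ : ∀ i j, Measurable fun w : E dx × E dz => jacobian s w.1 w.2 i j := fun i j => by
    have := measurable_fderiv_section hs hd (EuclideanSpace.single j 1)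
    exact (by fun_prop : Measurable fun u : E dx => u.ofLp i).comp this
  have hs' : ∀ i, Measurable fun w : E dx × E dz => (s w.1 w.2).ofLp i := fun i =>
    (by fun_prop : Measurable fun u : E dx => u.ofLp i).comp hs
  simp only [loss, dotProduct, Matrix.mulVec]
  refine Measurable.add ?_ (Measurable.const_mul (Measurable.pow_const ?_ _) _)
  · refine Finset.measurable_sum _ fun i _ => Measurable.mul (by fun_prop)
      (Finset.measurable_sum _ fun j _ => Measurable.mul ((hJ i j).comp measurable_fst)
        (by fun_prop))
  · exact Finset.measurable_sum _ fun i _ => Measurable.mul (by fun_prop)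
      ((hs' i).comp measurable_fst)

/-! ### Averages over a block of projection vectors -/

/-- The average `(1/m) ∑ⱼ F(y, vⱼ)` over the projection vectors of a block. -/
def blockAvg {α β : Type*} (m : ℕ) (F : α × β → ℝ) (w : α × (Fin m → β)) : ℝ :=
  1 / (m : ℝ) * ∑ j, F (w.1, w.2 j)

theorem empObjective_eq_blockAvg (s : E dx → E dz → E dx) (n : ℕ)
    (x : ℕ → E dx) (z : ℕ → E dz) (v : ℕ → Fin m → E dx) :
    empObjective s n x z v = (n : ℝ)⁻¹ * ∑ i ∈ Finset.range n,
      blockAvg m (fun w : (E dx × E dz) × E dx => loss s w.1.1 w.1.2 w.2)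
        ((x i, z i), fun j => v i j) := by
  simp only [empObjective, blockAvg, ← Finset.mul_sum]
  rw [one_div_mul_eq_div, div_eq_mul_inv, mul_inv]; ring

theorem abs_blockAvg_sub_le {α β : Type*} {F G L : α × β → ℝ} {c : ℝ}
    (h : ∀ w, |F w - G w| ≤ L w * c)
    (w : α × (Fin m → β)) : |blockAvg m F w - blockAvg m G w| ≤ blockAvg m L w * c := by
  simp only [blockAvg]
  rw [← mul_sub, ← Finset.sum_sub_distrib, abs_mul, abs_of_nonneg (by positivity), mul_assoc,
    Finset.sum_mul]
  gcongr
  exact (Finset.abs_sum_le_sum_abs _ _).trans (Finset.sum_le_sum fun j _ => h _)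

section BlockAvg

variable {α β : Type*} [MeasurableSpace α] [MeasurableSpace β]

theorem measurePreserving_block (P : Measure α) [IsProbabilityMeasure P] (Q : Measure β)
    [IsProbabilityMeasure Q] (j : Fin m) :
    MeasurePreserving (fun w : α × (Fin m → β) => (w.1, w.2 j))
      (P.prod (Measure.pi fun _ => Q)) (P.prod Q) :=
  (MeasurePreserving.id P).prod (measurePreserving_eval (fun _ : Fin m => Q) j)

theorem measurable_blockAvg {F : α × β → ℝ} (hF : Measurable F) : Measurable (blockAvg m F) := by
  unfold blockAvg
  fun_prop

variable {P : Measure α} [IsProbabilityMeasure P] {Q : Measure β} [IsProbabilityMeasure Q]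

theorem integrable_blockAvg {F : α × β → ℝ} (hF : Integrable F (P.prod Q)) :
    Integrable (blockAvg m F) (P.prod (Measure.pi fun _ => Q)) :=
  (integrable_finsetSum _ fun j _ =>
    (measurePreserving_block P Q j).integrable_comp_of_integrable hF).const_mul _

theorem integral_comp_block {F : α × β → ℝ} (hF : AEStronglyMeasurable F (P.prod Q)) (j : Fin m) :
    ∫ w : α × (Fin m → β), F (w.1, w.2 j) ∂(P.prod (Measure.pi fun _ => Q)) =
      ∫ w, F w ∂(P.prod Q) := by
  have h := measurePreserving_block P Q j
  conv_rhs => rw [← h.map_eq]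
  rw [integral_map h.aemeasurable (by rw [h.map_eq]; exact hF)]

theorem integral_blockAvg (hm : 0 < m) {F : α × β → ℝ} (hF : Integrable F (P.prod Q)) :
    ∫ w, blockAvg m F w ∂(P.prod (Measure.pi fun _ => Q)) = ∫ w, F w ∂(P.prod Q) := by
  have hm' : (m : ℝ) ≠ 0 := by exact_mod_cast hm.ne'
  unfold blockAvg
  have hs : ∀ j ∈ (Finset.univ : Finset (Fin m)), Integrable
      (fun w : α × (Fin m → β) => F (w.1, w.2 j)) (P.prod (Measure.pi fun _ => Q)) := fun j _ =>
    (measurePreserving_block P Q j).integrable_comp_of_integrable hF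
  rw [integral_const_mul, integral_finsetSum _ hs]
  simp only [integral_comp_block hF.1, Finset.sum_const, Finset.card_univ, Fintype.card_fin,
    nsmul_eq_mul]
  field_simp

theorem memLp_blockAvg {F : α × β → ℝ} (hF : MemLp F 2 (P.prod Q)) :
    MemLp (blockAvg m F) 2 (P.prod (Measure.pi fun _ => Q)) :=
  (memLp_finsetSum _ fun j _ =>
    hF.comp_measurePreserving (measurePreserving_block P Q j)).const_mul _

/-- Averaging within a block does not increase the second moment, by Cauchy–Schwarz; hence the final
rate is free of `m`. -/
theorem integral_blockAvg_sq_le (hm : 0 < m) {F : α × β → ℝ} (hF : MemLp F 2 (P.prod Q)) :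
    ∫ w, blockAvg m F w ^ 2 ∂(P.prod (Measure.pi fun _ => Q)) ≤ ∫ w, F w ^ 2 ∂(P.prod Q) := by
  have hm' : (0 : ℝ) < m := by exact_mod_cast hm
  rw [← integral_blockAvg hm hF.integrable_sq]
  refine integral_mono (memLp_blockAvg hF).integrable_sq (integrable_blockAvg hF.integrable_sq)
    fun w => ?_
  have h := sq_sum_le_card_mul_sum_sq (s := Finset.univ) (f := fun j => F (w.1, w.2 j))
  simp only [Finset.card_univ, Fintype.card_fin] at h
  simp only [blockAvg, mul_pow]
  calc (1 / (m : ℝ)) ^ 2 * (∑ j, F (w.1, w.2 j)) ^ 2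
      ≤ (1 / (m : ℝ)) ^ 2 * (m * ∑ j, F (w.1, w.2 j) ^ 2) := by gcongr
    _ = _ := by field_simp

end BlockAvg

/-! ### The population objective and identifiability -/

theorem isProbabilityMeasure_condLaw {p : E dx → E dz → ℝ} (hp : IsCondDensity p) (z : E dz) :
    IsProbabilityMeasure (condLaw p z) :=
  ⟨by rw [condLaw, withDensity_apply _ MeasurableSet.univ]; simpa using hp.lintegral_eq_one z⟩

theorem isProbabilityMeasure_jointLaw {p : E dx → E dz → ℝ} {q : E dz → ℝ} (hp : IsCondDensity p)
    (hq : IsDensity q) : IsProbabilityMeasure (jointLaw p q) := by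
  constructor
  rw [jointLaw, withDensity_apply _ MeasurableSet.univ, Measure.restrict_univ,
    Measure.volume_eq_prod]
  have hm : Measurable fun w : E dx × E dz => ENNReal.ofReal (jointDensity p q w.1 w.2) :=
    (hp.measurable.mul (hq.measurable.comp measurable_snd)).ennreal_ofReal
  rw [lintegral_prod_symm _ hm.aemeasurable, ← hq.lintegral_eq_one]
  refine lintegral_congr fun z => ?_
  simp only [jointDensity, ENNReal.ofReal_mul (hp.nonneg _ _)]
  rw [lintegral_mul_const' _ _ ENNReal.ofReal_ne_top, hp.lintegral_eq_one, one_mul]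

theorem hasFDerivAt_of_log {f : E dx → ℝ} (hpos : ∀ x, 0 < f x)
    (hd : Differentiable ℝ fun x => Real.log (f x)) (x : E dx) :
    HasFDerivAt f (f x • fderiv ℝ (fun x => Real.log (f x)) x) x := by
  have h := (hd x).hasFDerivAt.exp
  simp only [Real.exp_log (hpos _)] at h
  exact h

theorem integrable_withDensity_ofReal_iff {f : E dx → ℝ} (hf : Measurable f) (h0 : ∀ x, 0 ≤ f x)
    {g : E dx → ℝ} :
    Integrable g (volume.withDensity fun x => ENNReal.ofReal (f x)) ↔
      Integrable fun x => f x * g x := by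
  rw [integrable_withDensity_iff_integrable_smul' hf.ennreal_ofReal
    (ae_of_all _ fun _ => ENNReal.ofReal_lt_top)]
  simp only [ENNReal.toReal_ofReal (h0 _), smul_eq_mul]

theorem integral_withDensity_ofReal {β : Type*} [MeasurableSpace β] {ρ : Measure β} {f : β → ℝ}
    (hf : Measurable f) (h0 : ∀ x, 0 ≤ f x) (g : β → ℝ) :
    ∫ x, g x ∂(ρ.withDensity fun x => ENNReal.ofReal (f x)) = ∫ x, f x * g x ∂ρ := by
  rw [integral_withDensity_eq_integral_toReal_smul hf.ennreal_ofReal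
    (ae_of_all _ fun _ => ENNReal.ofReal_lt_top)]
  simp only [ENNReal.toReal_ofReal (h0 _), smul_eq_mul]

/-- Integration by parts: `E[vᵀ ∇h v] = - E[(vᵀ ∇ log p) (vᵀ h)]`. -/
theorem integral_inner_fderiv_eq_neg {f : E dx → ℝ} (hf : Measurable f) (hpos : ∀ x, 0 < f x)
    (hd : Differentiable ℝ fun x => Real.log (f x)) {h : E dx → E dx} (hh : Differentiable ℝ h)
    (v : E dx) {ρ : Measure (E dx)} (hρ : ρ = volume.withDensity fun x => ENNReal.ofReal (f x))
    (h1 : Integrable (fun x => inner ℝ v (fderiv ℝ h x v)) ρ)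
    (h2 : Integrable (fun x => inner ℝ v (gradient (fun x' => Real.log (f x')) x) *
      inner ℝ v (h x)) ρ)
    (h3 : Integrable (fun x => inner ℝ v (h x)) ρ) :
    ∫ x, inner ℝ v (fderiv ℝ h x v) ∂ρ =
      -∫ x, inner ℝ v (gradient (fun x' => Real.log (f x')) x) * inner ℝ v (h x) ∂ρ := by
  subst hρ
  have h0 : ∀ x, 0 ≤ f x := fun x => (hpos x).le
  rw [integrable_withDensity_ofReal_iff hf h0] at h1 h2 h3
  rw [integral_withDensity_ofReal hf h0, integral_withDensity_ofReal hf h0]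
  have hff := hasFDerivAt_of_log hpos hd
  have hfv : ∀ x, fderiv ℝ f x v = f x * inner ℝ v (gradient (fun x' => Real.log (f x')) x) := by
    intro x
    rw [(hff x).fderiv, real_inner_comm, inner_gradient_left]; rfl
  have hgv : ∀ x, fderiv ℝ (fun x => inner ℝ v (h x)) x v = inner ℝ v (fderiv ℝ h x v) := by
    intro x
    have := ((innerSL ℝ v).hasFDerivAt.comp x (hh x).hasFDerivAt).fderiv
    exact congrArg (fun L => L v) this
  -- Integrability of the three products makes the boundary terms vanish.
  have key := integral_mul_fderiv_eq_neg_fderiv_mul_of_integrable (μ := volume) (v := v)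
    (f := f) (g := fun x => inner ℝ v (h x))
    (by simpa only [hfv, mul_assoc] using h2) (by simpa only [hgv] using h1) h3
    (fun x _ => (hff x).differentiableAt)
    (fun x _ => ((innerSL ℝ v).hasFDerivAt.comp x (hh x).hasFDerivAt).differentiableAt)
  simpa only [hgv, hfv, mul_assoc] using key

theorem memLp_inner_of_sq_integrable {ρ : Measure (E dx)} {s : E dx → E dx} (hs : Continuous s)
    (h : Integrable (fun x => ‖s x‖ ^ 2) ρ) (v : E dx) :
    MemLp (fun x => inner ℝ v (s x)) 2 ρ := by
  have h' : MemLp s 2 ρ := by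
    rw [← memLp_norm_iff hs.aestronglyMeasurable]
    exact (memLp_two_iff_integrable_sq hs.norm.aestronglyMeasurable).2 h
  exact h'.const_inner v

/-- Given `z` and `v`, the expected excess loss of a score `s'` over the true score `s` is
`½ E[(vᵀ (s' - s))²]`. -/
theorem integral_loss_sub_eq {p : E dx → E dz → ℝ} (hp : IsCondDensity p)
    (hpos : ∀ x z, 0 < p x z) {s' : E dx → E dz → E dx} (hreg : RegularScore p p)
    {z : E dz} (hs' : Differentiable ℝ fun x => s' x z)
    (hs'2 : Integrable (fun x => ‖s' x z‖ ^ 2) (condLaw p z)) (v : E dx)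
    (hint : Integrable (fun x => loss s' x z v - loss (score p) x z v) (condLaw p z)) :
    ∫ x, (loss s' x z v - loss (score p) x z v) ∂(condLaw p z) =
      1 / 2 * ∫ x, inner ℝ v (s' x z - score p x z) ^ 2 ∂(condLaw p z) ∧
    Integrable (fun x => inner ℝ v (s' x z - score p x z) ^ 2) (condLaw p z) := by
  have := isProbabilityMeasure_condLaw hp z
  have hs := hreg.score_differentiable z
  have hh : Differentiable ℝ fun x => s' x z - score p x z := hs'.sub hs
  have m1 := memLp_inner_of_sq_integrable hs.continuous (hreg.sq_integrable z) v
  have m2 := memLp_inner_of_sq_integrable hs'.continuous hs'2 v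
  have m3 : MemLp (fun x => inner ℝ v (s' x z - score p x z)) 2 (condLaw p z) := by
    simp only [inner_sub_right]; exact m2.sub m1
  have i2 : Integrable (fun x => inner ℝ v (score p x z) *
      inner ℝ v (s' x z - score p x z)) (condLaw p z) := m1.integrable_mul m3
  -- With `h = s' - s`, the quadratic terms differ by `(vᵀ s)(vᵀ h) + ½ (vᵀ h)²`. Integration by
  -- parts cancels the cross term against the derivative term.
  have hloss : ∀ x, loss s' x z v - loss (score p) x z v =
      inner ℝ v (fderiv ℝ (fun x => s' x z - score p x z) x v) +
        (inner ℝ v (score p x z) * inner ℝ v (s' x z - score p x z) +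
        1 / 2 * inner ℝ v (s' x z - score p x z) ^ 2) := by
    intro x
    rw [loss_eq_inner, loss_eq_inner, fderiv_fun_sub (hs' x) (hs x), _root_.sub_apply,
      inner_sub_right, inner_sub_right]
    ring
  have i3 := m3.integrable_sq
  have i4 : Integrable (fun x => inner ℝ v (score p x z) * inner ℝ v (s' x z - score p x z) +
        1 / 2 * inner ℝ v (s' x z - score p x z) ^ 2) (condLaw p z) := i2.add (i3.const_mul _)
  -- The other terms are products of square-integrable functions, so integrability of the derivative
  -- term follows from that of the excess loss.
  have i1 : Integrable (fun x => inner ℝ v (fderiv ℝ (fun x => s' x z - score p x z) x v))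
      (condLaw p z) := by
    refine (hint.sub i4).congr (ae_of_all _ fun x => ?_)
    simp only [Pi.sub_apply, hloss x]; ring
  refine ⟨?_, i3⟩
  have hibp : ∫ x, inner ℝ v (fderiv ℝ (fun x => s' x z - score p x z) x v) ∂(condLaw p z) =
      -∫ x, inner ℝ v (score p x z) * inner ℝ v (s' x z - score p x z) ∂(condLaw p z) :=
    integral_inner_fderiv_eq_neg (hp.measurable.comp measurable_prodMk_right) (fun x => hpos x z)
      (hreg.log_differentiable z) hh v rfl i1 i2 (m3.integrable one_le_two)
  simp only [hloss]
  rw [integral_add i1 i4, integral_add i2 (i3.const_mul _), integral_const_mul, hibp]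
  ring

/-- By Fubini the integral is a `q`-weighted integral over `z` of half the second moments. When it
vanishes, so do these for almost every `z`; positivity of `p` makes the projected difference zero
for Lebesgue-almost every `x`, and continuity extends this to every `x`. -/
theorem integral_jointLaw_loss_sub_nonneg {p : E dx → E dz → ℝ} {q : E dz → ℝ}
    (hp : IsCondDensity p) (hq : IsDensity q) (hpos : ∀ x z, 0 < p x z) (hqpos : ∀ z, 0 < q z)
    {s' : E dx → E dz → E dx} (hreg : RegularScore p p)
    (hs' : ∀ z, Differentiable ℝ fun x => s' x z)
    (hs'2 : ∀ z, Integrable (fun x => ‖s' x z‖ ^ 2) (condLaw p z)) (v : E dx)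
    (hint : Integrable (fun w : E dx × E dz => loss s' w.1 w.2 v - loss (score p) w.1 w.2 v)
      (jointLaw p q)) :
    0 ≤ ∫ w, (loss s' w.1 w.2 v - loss (score p) w.1 w.2 v) ∂(jointLaw p q) ∧
    (∫ w, (loss s' w.1 w.2 v - loss (score p) w.1 w.2 v) ∂(jointLaw p q) = 0 →
      ∀ᵐ z, ∀ x, inner ℝ v (s' x z - score p x z) = 0) := by
  set φ : E dx × E dz → ℝ := fun w => loss s' w.1 w.2 v - loss (score p) w.1 w.2 v with hφ
  have hjm : Measurable fun w : E dx × E dz => jointDensity p q w.1 w.2 :=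
    hp.measurable.mul (hq.measurable.comp measurable_snd)
  have hj0 : ∀ w : E dx × E dz, 0 ≤ jointDensity p q w.1 w.2 := fun w =>
    mul_nonneg (hp.nonneg _ _) (hq.nonneg _)
  have hpz : ∀ z, Measurable fun x => p x z := fun z => hp.measurable.comp measurable_prodMk_right
  have hI : Integrable (fun w : E dx × E dz => jointDensity p q w.1 w.2 * φ w)
      ((volume : Measure (E dx)).prod (volume : Measure (E dz))) := by
    rw [← Measure.volume_eq_prod]
    rw [jointLaw, integrable_withDensity_iff_integrable_smul' hjm.ennreal_ofReal
      (ae_of_all _ fun _ => ENNReal.ofReal_lt_top)] at hint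
    simpa only [ENNReal.toReal_ofReal (hj0 _), smul_eq_mul] using hint
  let Ψ : E dz → ℝ := fun z => ∫ x, jointDensity p q x z * φ (x, z)
  have hΨI : Integrable Ψ := hI.integral_prod_right
  have hval : ∫ w, φ w ∂(jointLaw p q) = ∫ z, Ψ z := by
    rw [jointLaw, integral_withDensity_ofReal hjm hj0, Measure.volume_eq_prod,
      integral_prod_symm _ hI]
  have hΨ : ∀ᵐ z, Ψ z = q z * (1 / 2 * ∫ x, inner ℝ v (s' x z - score p x z) ^ 2 ∂(condLaw p z)) ∧
      Integrable (fun x => inner ℝ v (s' x z - score p x z) ^ 2) (condLaw p z) := by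
    filter_upwards [hI.prod_left_ae] with z hz
    have hz' : Integrable (fun x => φ (x, z)) (condLaw p z) := by
      rw [condLaw, integrable_withDensity_ofReal_iff (hpz z) fun x => hp.nonneg x z]
      refine (hz.const_mul (q z)⁻¹).congr (ae_of_all _ fun x => ?_)
      have := (hqpos z).ne'
      simp only [jointDensity]
      field_simp
    have h := integral_loss_sub_eq hp hpos hreg (hs' z) (hs'2 z) v hz'
    refine ⟨?_, h.2⟩
    rw [← h.1, condLaw, integral_withDensity_ofReal (hpz z) fun x => hp.nonneg x z,
      ← integral_const_mul]
    refine integral_congr_ae (ae_of_all _ fun x => ?_)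
    simp only [jointDensity, hφ]
    ring
  have hΨ0 : 0 ≤ᵐ[volume] Ψ := by
    filter_upwards [hΨ] with z hz
    rw [hz.1]
    exact mul_nonneg (hq.nonneg z) (mul_nonneg (by norm_num) (integral_nonneg fun x => sq_nonneg _))
  rw [hval]
  refine ⟨integral_nonneg_of_ae hΨ0, fun h0 => ?_⟩
  rw [integral_eq_zero_iff_of_nonneg_ae hΨ0 hΨI] at h0
  filter_upwards [h0, hΨ] with z hz0 hz
  rw [hz.1] at hz0
  have hz1 : ∫ x, inner ℝ v (s' x z - score p x z) ^ 2 ∂(condLaw p z) = 0 := by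
    have := (hqpos z).ne'
    simpa [this] using hz0
  rw [integral_eq_zero_iff_of_nonneg (fun x => sq_nonneg _) hz.2] at hz1
  have hac : (volume : Measure (E dx)) ≪ condLaw p z :=
    withDensity_absolutelyContinuous' (hpz z).ennreal_ofReal.aemeasurable
      (ae_of_all _ fun x => by simpa using hpos x z)
  have hcont : Continuous fun x => inner ℝ v (s' x z - score p x z) ^ 2 :=
    (continuous_const.inner ((hs' z).continuous.sub
      (hreg.score_differentiable z).continuous)).pow 2
  have heq := (Continuous.ae_eq_iff_eq (volume : Measure (E dx)) hcont continuous_zero).1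
    (hac.ae_eq hz1)
  intro x
  simpa using congrFun heq x

/-- `E[v vᵀ] u = E[v (vᵀ u)] = 0`, which contradicts positive definiteness unless `u = 0`. -/
theorem eq_zero_of_ae_inner_eq_zero {pv : Measure (E dx)} (hpv : RegularProjection pv) {u : E dx}
    (h : ∀ᵐ v ∂pv, inner ℝ v u = 0) : u = 0 := by
  by_contra hu
  have hu' : u.ofLp ≠ 0 := fun h0 => hu ((WithLp.ofLp_eq_zero 2).1 h0)
  have hI : ∀ i j, Integrable (fun v : E dx => outer v i j) pv := by
    intro i j
    refine hpv.sq_integrable.mono' ?_ (ae_of_all _ fun v => ?_)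
    · simp only [outer, Matrix.vecMulVec_apply]
      exact (by fun_prop : Measurable fun v : E dx => v.ofLp i * v.ofLp j).aestronglyMeasurable
    · simp only [outer, Matrix.vecMulVec_apply, norm_mul, sq]
      gcongr <;> exact PiLp.norm_apply_le _ _
  have hzero : (Matrix.of fun i j => ∫ v : E dx, outer v i j ∂pv) *ᵥ u.ofLp = 0 := by
    ext i
    simp only [Matrix.mulVec, dotProduct, Matrix.of_apply, Pi.zero_apply]
    simp only [← integral_mul_const]
    rw [← integral_finsetSum _ fun j _ => (hI i j).mul_const _]
    refine integral_eq_zero_of_ae ?_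
    filter_upwards [h] with v hv
    have : inner ℝ v u = ∑ j, v.ofLp j * u.ofLp j := by
      simp [PiLp.inner_apply, mul_comm]
    simp only [outer, Matrix.vecMulVec_apply, mul_assoc, ← Finset.mul_sum, ← this, hv, mul_zero,
      Pi.zero_apply]
  have := hpv.posDef.dotProduct_mulVec_pos hu'
  rw [hzero] at this
  simp at this

/-- Conditional densities with the same score coincide. -/
theorem eq_of_score_eq {p p' : E dx → E dz → ℝ} (hp : IsCondDensity p) (hp' : IsCondDensity p')
    {z : E dz} (hpos : ∀ x, 0 < p x z) (hpos' : ∀ x, 0 < p' x z)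
    (hd : Differentiable ℝ fun x => Real.log (p x z))
    (hd' : Differentiable ℝ fun x => Real.log (p' x z))
    (h : ∀ x, score p' x z = score p x z) (x : E dx) : p' x z = p x z := by
  have hf : ∀ x, fderiv ℝ (fun x => Real.log (p' x z) - Real.log (p x z)) x = 0 := by
    intro x
    rw [fderiv_fun_sub (hd' x) (hd x), sub_eq_zero]
    ext y
    rw [← inner_gradient_left, ← inner_gradient_left]
    exact congrArg (fun u => inner ℝ u y) (h x)
  have hc := is_const_of_fderiv_eq_zero (𝕜 := ℝ) (hd'.sub hd) hf
  -- The log-ratio has zero derivative, so the densities are proportional with ratio `c`; both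
  -- integrate to one, so `c = 1`.
  set c : ℝ := Real.exp (Real.log (p' 0 z) - Real.log (p 0 z)) with hcdef
  have hpc : ∀ x, p' x z = c * p x z := by
    intro x
    have h1 : Real.log (p' x z) - Real.log (p x z) = Real.log (p' 0 z) - Real.log (p 0 z) := hc x 0
    rw [hcdef, ← h1, Real.exp_sub, Real.exp_log (hpos' x), Real.exp_log (hpos x)]
    have := (hpos x).ne'
    field_simp
  have hc0 : 0 < c := Real.exp_pos _
  have hc1 : ENNReal.ofReal c = 1 := by
    have h1 := hp'.lintegral_eq_one z
    simp only [hpc, ENNReal.ofReal_mul hc0.le] at h1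
    rwa [lintegral_const_mul' _ _ ENNReal.ofReal_ne_top, hp.lintegral_eq_one z, mul_one] at h1
  rw [hpc x, ENNReal.ofReal_eq_one.1 hc1, one_mul]

theorem blockAvg_sub {α β : Type*} (F G : α × β → ℝ) (w : α × (Fin m → β)) :
    blockAvg m (fun y => F y - G y) w = blockAvg m F w - blockAvg m G w := by
  simp only [blockAvg, Finset.sum_sub_distrib, mul_sub]

/-! ### The excess loss: integrability, positivity and separation. -/

namespace Assumptions

variable {Θ : Set (E d)} {θstar : E d} {pM : E d → E dx → E dz → ℝ} {p : E dx → E dz → ℝ}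
  {q : E dz → ℝ} {pv : Measure (E dx)} {L₁ L₂ : E dx → E dz → ℝ}

theorem density_pos (A : Assumptions Θ θstar pM p q pv L₁ L₂) (z : E dz) : 0 < q z := by
  have h := A.positive θstar A.identifiable.mem 0 z
  exact lt_of_le_of_ne (A.density.nonneg z) fun h0 => by simp [jointDensity, ← h0] at h

theorem model_pos (A : Assumptions Θ θstar pM p q pv L₁ L₂) {θ : E d} (hθ : θ ∈ Θ) (x : E dx)
    (z : E dz) : 0 < pM θ x z :=
  pos_of_mul_pos_left (A.positive θ hθ x z) (A.density.nonneg z)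

theorem model_star_eq (A : Assumptions Θ θstar pM p q pv L₁ L₂) : pM θstar = p := by
  ext x z
  exact (mul_right_cancel₀ (A.density_pos z).ne' (A.identifiable.wellSpecified x z)).symm

/-- The excess one-sample loss over the true parameter. -/
def excess (pM : E d → E dx → E dz → ℝ) (θstar θ : E d) (w : (E dx × E dz) × E dx) : ℝ :=
  loss (score (pM θ)) w.1.1 w.1.2 w.2 - loss (score (pM θstar)) w.1.1 w.1.2 w.2

theorem measurable_loss_model (A : Assumptions Θ θstar pM p q pv L₁ L₂) {θ : E d} (hθ : θ ∈ Θ) :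
    Measurable fun w : (E dx × E dz) × E dx => loss (score (pM θ)) w.1.1 w.1.2 w.2 :=
  measurable_loss (measurable_score (A.condDensity_model θ hθ).measurable
    (A.regularScore_model θ hθ).log_differentiable) (A.regularScore_model θ hθ).score_differentiable

theorem measurable_excess (A : Assumptions Θ θstar pM p q pv L₁ L₂) {θ : E d} (hθ : θ ∈ Θ) :
    Measurable (excess pM θstar θ) :=
  (A.measurable_loss_model hθ).sub (A.measurable_loss_model A.identifiable.mem)

theorem isProbabilityMeasure_jointLaw (A : Assumptions Θ θstar pM p q pv L₁ L₂) :
    IsProbabilityMeasure (jointLaw p q) :=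
  CSSM.isProbabilityMeasure_jointLaw A.condDensity A.density

theorem abs_excess_sub_le (A : Assumptions Θ θstar pM p q pv L₁ L₂) {θ₁ θ₂ : E d} (h₁ : θ₁ ∈ Θ)
    (h₂ : θ₂ ∈ Θ) (w : (E dx × E dz) × E dx) :
    |excess pM θstar θ₁ w - excess pM θstar θ₂ w| ≤
      lossLipschitz L₁ L₂ w.1.1 w.1.2 w.2 * dist θ₁ θ₂ := by
  refine le_trans (le_of_eq ?_) (A.lipschitz.abs_loss_sub_le h₁ h₂ w.1.1 w.1.2 w.2)
  simp only [excess]; congr 1; ring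

theorem memLp_lossLipschitz (A : Assumptions Θ θstar pM p q pv L₁ L₂) :
    MemLp (fun w : (E dx × E dz) × E dx => lossLipschitz L₁ L₂ w.1.1 w.1.2 w.2) 2
      ((jointLaw p q).prod pv) :=
  have := A.isProbabilityMeasure
  have := A.isProbabilityMeasure_jointLaw
  CSSM.memLp_lossLipschitz A.lipschitz A.boundedMoments

/-- The excess vanishes at `θstar`, so the Lipschitz bound dominates it; the losses themselves need
not be integrable. -/
theorem integrable_excess (A : Assumptions Θ θstar pM p q pv L₁ L₂) {θ : E d} (hθ : θ ∈ Θ) :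
    Integrable (excess pM θstar θ) ((jointLaw p q).prod pv) := by
  have := A.isProbabilityMeasure
  have := A.isProbabilityMeasure_jointLaw
  refine ((A.memLp_lossLipschitz.integrable one_le_two).mul_const (dist θ θstar)).mono'
    (A.measurable_excess hθ).aestronglyMeasurable (ae_of_all _ fun w => ?_)
  simpa [excess] using A.abs_excess_sub_le hθ A.identifiable.mem w

theorem continuousOn_integral_excess (A : Assumptions Θ θstar pM p q pv L₁ L₂) :
    ContinuousOn (fun θ => ∫ w, excess pM θstar θ w ∂((jointLaw p q).prod pv)) Θ := by
  have := A.isProbabilityMeasure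
  have := A.isProbabilityMeasure_jointLaw
  have hL := A.memLp_lossLipschitz.integrable one_le_two
  refine LipschitzOnWith.continuousOn (K := Real.toNNReal
    (∫ w, lossLipschitz L₁ L₂ w.1.1 w.1.2 w.2 ∂((jointLaw p q).prod pv))) ?_
  refine LipschitzOnWith.of_dist_le_mul fun θ₁ h₁ θ₂ h₂ => ?_
  rw [Real.dist_eq, ← integral_sub (A.integrable_excess h₁) (A.integrable_excess h₂)]
  calc |∫ w, (excess pM θstar θ₁ w - excess pM θstar θ₂ w) ∂((jointLaw p q).prod pv)|
      ≤ ∫ w, lossLipschitz L₁ L₂ w.1.1 w.1.2 w.2 * dist θ₁ θ₂ ∂((jointLaw p q).prod pv) :=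
        abs_integral_le_integral_abs.trans (integral_mono
          ((A.integrable_excess h₁).sub (A.integrable_excess h₂)).abs (hL.mul_const _)
          fun w => A.abs_excess_sub_le h₁ h₂ w)
    _ ≤ _ := by
        rw [integral_mul_const]
        gcongr
        exact Real.le_coe_toNNReal _

/-- The true parameter is the unique minimizer of the expected excess loss. -/
theorem integral_excess_pos (A : Assumptions Θ θstar pM p q pv L₁ L₂) {θ : E d} (hθ : θ ∈ Θ)
    (hne : θ ≠ θstar) : 0 < ∫ w, excess pM θstar θ w ∂((jointLaw p q).prod pv) := by
  have := A.isProbabilityMeasure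
  have := A.isProbabilityMeasure_jointLaw
  have hI := A.integrable_excess hθ
  have hpp : ∀ x z, 0 < p x z := fun x z => by
    simpa [A.model_star_eq] using A.model_pos A.identifiable.mem x z
  have hreg := A.regularScore
  have hregθ := A.regularScore_model θ hθ
  let I : E dx → ℝ := fun v => ∫ w, excess pM θstar θ (w, v) ∂(jointLaw p q)
  have hkey : ∀ᵐ v ∂pv, 0 ≤ I v ∧
      (I v = 0 → ∀ᵐ z, ∀ x, inner ℝ v (score (pM θ) x z - score p x z) = 0) := by
    filter_upwards [hI.prod_left_ae] with v hv
    simp only [excess, A.model_star_eq] at hv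
    have := integral_jointLaw_loss_sub_nonneg A.condDensity A.density hpp A.density_pos hreg
      hregθ.score_differentiable hregθ.sq_integrable v hv
    simpa only [I, excess, A.model_star_eq] using this
  have hI0 : 0 ≤ᵐ[pv] I := hkey.mono fun v hv => hv.1
  rw [integral_prod_symm _ hI]
  refine lt_of_le_of_ne (integral_nonneg_of_ae hI0) fun h0 => ?_
  have hIz := (integral_eq_zero_iff_of_nonneg_ae hI0 hI.integral_prod_right).1 h0.symm
  have hall : ∀ᵐ v ∂pv, ∀ᵐ z, ∀ x, inner ℝ v (score (pM θ) x z - score p x z) = 0 := by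
    filter_upwards [hkey, hIz] with v h1 h2 using h1.2 h2
  have hmθ : Measurable (Function.uncurry (score (pM θ))) :=
    measurable_score (A.condDensity_model θ hθ).measurable hregθ.log_differentiable
  have hmp : Measurable (Function.uncurry (score p)) :=
    measurable_score A.condDensity.measurable hreg.log_differentiable
  -- Fixing `x` makes the relation between `v` and `z` visibly measurable, so their
  -- almost-everywhere quantifiers can be exchanged.
  have hx : ∀ x : E dx, ∀ᵐ z : E dz, score (pM θ) x z = score p x z := by
    intro x
    have hms : MeasurableSet {y : E dx × E dz |
        inner ℝ y.1 (score (pM θ) x y.2 - score p x y.2) = 0} := by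
      have h1 : Measurable fun z => score (pM θ) x z := hmθ.comp measurable_prodMk_left
      have h2 : Measurable fun z => score p x z := hmp.comp measurable_prodMk_left
      exact measurableSet_eq_fun
        (measurable_fst.inner ((h1.comp measurable_snd).sub (h2.comp measurable_snd)))
        measurable_const
    have h1 : ∀ᵐ v ∂pv, ∀ᵐ z : E dz, inner ℝ v (score (pM θ) x z - score p x z) = 0 :=
      hall.mono fun v hv => hv.mono fun z hz => hz x
    have h2 : ∀ᵐ z : E dz, ∀ᵐ v ∂pv, inner ℝ v (score (pM θ) x z - score p x z) = 0 :=
      (Measure.ae_ae_comm hms).1 h1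
    exact h2.mono fun z hz => sub_eq_zero.1 (eq_zero_of_ae_inner_eq_zero A.regularProjection hz)
  -- The null set of `z` is made independent of `x` along a countable dense set; continuity of the
  -- scores gives the remaining `x`.
  have hz : ∀ᵐ z : E dz, ∀ x, score (pM θ) x z = score p x z := by
    have := ae_all_iff.2 fun k : ℕ => hx (TopologicalSpace.denseSeq (E dx) k)
    filter_upwards [this] with z hz x
    refine congrFun (Continuous.ext_on (TopologicalSpace.denseRange_denseSeq (E dx))
      (hregθ.score_differentiable z).continuous (hreg.score_differentiable z).continuous ?_) x
    rintro _ ⟨k, rfl⟩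
    exact hz k
  refine A.identifiable.identifiable θ hθ hne ?_
  rw [A.model_star_eq]
  have hm1 : Measurable fun w : E dx × E dz => jointDensity (pM θ) q w.1 w.2 :=
    (A.condDensity_model θ hθ).measurable.mul (A.density.measurable.comp measurable_snd)
  have hm2 : Measurable fun w : E dx × E dz => jointDensity p q w.1 w.2 :=
    A.condDensity.measurable.mul (A.density.measurable.comp measurable_snd)
  rw [Measure.volume_eq_prod]
  refine (Measure.ae_prod_iff_ae_ae (measurableSet_eq_fun hm1 hm2)).2
    ((Measure.ae_ae_comm (p := fun (x : E dx) (z : E dz) =>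
      jointDensity (pM θ) q x z = jointDensity p q x z) (measurableSet_eq_fun hm1 hm2)).2 ?_)
  filter_upwards [hz] with z hz
  refine ae_of_all _ fun x => ?_
  rw [jointDensity, jointDensity, eq_of_score_eq A.condDensity (A.condDensity_model θ hθ)
    (fun x => hpp x z) (fun x => A.model_pos hθ x z) (hreg.log_differentiable z)
    (hregθ.log_differentiable z) hz x]

/-- The expected excess is continuous and positive on the compact set of parameters at distance at
least `ε`, so it attains a positive minimum there; if that set is empty, any `η` serves. -/
theorem exists_pos_le_integral_excess (A : Assumptions Θ θstar pM p q pv L₁ L₂) {ε : ℝ}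
    (hε : 0 < ε) : ∃ η > 0, ∀ θ ∈ Θ, ε ≤ dist θ θstar →
      η ≤ ∫ w, excess pM θstar θ w ∂((jointLaw p q).prod pv) := by
  have hK : IsCompact (Θ ∩ {θ | ε ≤ dist θ θstar}) :=
    A.compact.inter_right (isClosed_le continuous_const (continuous_id.dist continuous_const))
  rcases (Θ ∩ {θ | ε ≤ dist θ θstar}).eq_empty_or_nonempty with h | h
  · exact ⟨1, one_pos, fun θ hθ hd => absurd (h ▸ ⟨hθ, hd⟩ : θ ∈ (∅ : Set (E d))) (by simp)⟩
  · obtain ⟨θm, hm, hmin⟩ := hK.exists_isMinOn h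
      (A.continuousOn_integral_excess.mono Set.inter_subset_left)
    refine ⟨_, A.integral_excess_pos hm.1 fun he => ?_, fun θ hθ hd => hmin ⟨hθ, hd⟩⟩
    have : ε ≤ dist θm θstar := hm.2
    rw [he, dist_self] at this
    linarith

/-! ### Deviations along the sample and convergence of minimizers. -/

variable {Ω : Type*} [MeasurableSpace Ω] {μ : Measure Ω}
  {X : ℕ → Ω → E dx} {Z : ℕ → Ω → E dz} {V : ℕ → Fin m → Ω → E dx}

/-- A measurable majorant of the deviation of the empirical excess loss, with the rate for its
expectation. -/
theorem exists_majorant [IsProbabilityMeasure μ] (A : Assumptions Θ θstar pM p q pv L₁ L₂)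
    (hm : 0 < m)
    (S : IsSample μ (jointLaw p q) pv X Z V) {n : ℕ} (hn : 0 < n) :
    ∃ H : Ω → ℝ≥0∞, AEMeasurable H μ ∧
      (∀ ω, ∀ θ ∈ Θ, ENNReal.ofReal |empObjective (score (pM θ)) n
          (fun i => X i ω) (fun i => Z i ω) (fun i j => V i j ω) -
        empObjective (score (pM θstar)) n (fun i => X i ω) (fun i => Z i ω) (fun i j => V i j ω) -
        ∫ w, excess pM θstar θ w ∂((jointLaw p q).prod pv)| ≤ H ω) ∧
      ∫⁻ ω, H ω ∂μ ≤ ENNReal.ofReal (26 * Metric.diam Θ * √((d : ℝ) / n) *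
        √(∫ w, lossLipschitz L₁ L₂ w.1.1 w.1.2 w.2 ^ 2 ∂((jointLaw p q).prod pv))) := by
  have := A.isProbabilityMeasure
  have := A.isProbabilityMeasure_jointLaw
  obtain ⟨H, hH, hle, hint⟩ := exists_majorant_empirical_process A.compact.isBounded
    A.identifiable.mem ((jointLaw p q).prod (Measure.pi fun _ : Fin m => pv))
    (g := fun θ => blockAvg m (excess pM θstar θ))
    (l := blockAvg m fun w => lossLipschitz L₁ L₂ w.1.1 w.1.2 w.2)
    (fun θ hθ => measurable_blockAvg (A.measurable_excess hθ))
    (fun θ hθ => integrable_blockAvg (A.integrable_excess hθ))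
    (fun w => by simp [blockAvg, excess])
    (memLp_blockAvg A.memLp_lossLipschitz)
    (fun θ₁ h₁ θ₂ h₂ => abs_blockAvg_sub_le fun w => A.abs_excess_sub_le h₁ h₂ w)
    S.indep S.hasLaw hn
  refine ⟨H, hH, fun ω θ hθ => ?_, hint.trans (ENNReal.ofReal_le_ofReal ?_)⟩
  · refine le_trans (le_of_eq ?_) (hle ω θ hθ)
    rw [Real.enorm_eq_ofReal_abs, integral_blockAvg hm (A.integrable_excess hθ)]
    have : excess pM θstar θ = fun y : (E dx × E dz) × E dx =>
      loss (score (pM θ)) y.1.1 y.1.2 y.2 - loss (score (pM θstar)) y.1.1 y.1.2 y.2 := rfl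
    simp only [empObjective_eq_blockAvg, this, blockAvg_sub, Finset.sum_sub_distrib, mul_sub]
  · rw [finrank_euclideanSpace_fin]
    gcongr
    exact integral_blockAvg_sq_le hm A.memLp_lossLipschitz

theorem tendsto_rate (D c : ℝ) : Tendsto (fun n : ℕ => ENNReal.ofReal
    (26 * D * √((d : ℝ) / n) * c)) atTop (𝓝 0) := by
  have h : Tendsto (fun n : ℕ => 26 * D * √((d : ℝ) / n) * c) atTop (𝓝 0) := by
    have h1 := (Real.continuous_sqrt.tendsto 0).comp
      (tendsto_const_div_atTop_nhds_zero_nat (d : ℝ))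
    rw [Real.sqrt_zero] at h1
    simpa using (h1.const_mul (26 * D)).mul_const c
  simpa using ENNReal.tendsto_ofReal h

/-- At a minimizer the empirical excess is at most zero. If that minimizer is `ε`-far from `θstar`,
the population excess is at least `η`, so the majorant is at least `η`, and Markov's inequality
applies. Minimizers need not be measurable, since only the majorant is integrated. -/
theorem tendstoInMeasure [IsProbabilityMeasure μ] (A : Assumptions Θ θstar pM p q pv L₁ L₂)
    (hm : 0 < m)
    (S : IsSample μ (jointLaw p q) pv X Z V) {θhat : ℕ → Ω → E d}
    (hmin : ∀ n, ∀ᵐ ω ∂μ, θhat n ω ∈ Θ ∧ IsMinOn (fun θ => empObjective (score (pM θ)) n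
      (fun i => X i ω) (fun i => Z i ω) (fun i j => V i j ω)) Θ (θhat n ω)) :
    TendstoInMeasure μ θhat atTop (fun _ => θstar) := by
  rw [tendstoInMeasure_iff_dist]
  intro ε hε
  obtain ⟨η, hη, hsep⟩ := A.exists_pos_le_integral_excess hε
  have hrate := tendsto_rate (d := d) (Metric.diam Θ)
    (√(∫ w, lossLipschitz L₁ L₂ w.1.1 w.1.2 w.2 ^ 2 ∂((jointLaw p q).prod pv)))
  have hη' : ENNReal.ofReal η ≠ 0 := by simpa using hη
  have hdiv := ENNReal.Tendsto.div_const hrate (Or.inr hη')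
  rw [ENNReal.zero_div] at hdiv
  refine tendsto_of_tendsto_of_tendsto_of_le_of_le' tendsto_const_nhds hdiv
    (Eventually.of_forall fun _ => zero_le) ?_
  filter_upwards [eventually_gt_atTop 0] with n hn
  obtain ⟨H, hH, hle, hint⟩ := A.exists_majorant hm S hn
  calc μ {ω | ε ≤ dist (θhat n ω) θstar} ≤ μ {ω | ENNReal.ofReal η ≤ H ω} := by
        refine measure_mono_ae ?_
        filter_upwards [hmin n] with ω hω hd
        refine le_trans (ENNReal.ofReal_le_ofReal ?_) (hle ω _ hω.1)
        have h1 := hω.2 A.identifiable.mem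
        have h2 := hsep _ hω.1 hd
        simp only [Set.mem_ofPred_eq] at h1
        rw [abs_of_nonpos (by linarith)]
        linarith
    _ ≤ (∫⁻ ω, H ω ∂μ) / ENNReal.ofReal η :=
        meas_ge_le_lintegral_div hH hη' ENNReal.ofReal_ne_top
    _ ≤ _ := by gcongr

/-- Supplies what the excess loses by centring: the deviation at the single parameter `θstar`,
controlled by the `L¹` law of large numbers for the block averages. -/
theorem tendsto_lintegral_empObjective_sub (A : Assumptions Θ θstar pM p q pv L₁ L₂) (hm : 0 < m)
    (S : IsSample μ (jointLaw p q) pv X Z V)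
    (hstar : Integrable (fun w => loss (score (pM θstar)) w.1.1 w.1.2 w.2)
      ((jointLaw p q).prod pv)) :
    Tendsto (fun n => ∫⁻ ω, ENNReal.ofReal |empObjective (score (pM θstar)) n
        (fun i => X i ω) (fun i => Z i ω) (fun i j => V i j ω) -
      objective (score (pM θstar)) (jointLaw p q) pv| ∂μ) atTop (𝓝 0) := by
  have := A.isProbabilityMeasure
  have := A.isProbabilityMeasure_jointLaw
  set F : (E dx × E dz) × E dx → ℝ := fun w => loss (score (pM θstar)) w.1.1 w.1.2 w.2 with hF
  let Y : ℕ → Ω → ℝ := fun i ω => blockAvg m F ((X i ω, Z i ω), fun j => V i j ω)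
  have hFm : Measurable (blockAvg m F) :=
    measurable_blockAvg (A.measurable_loss_model A.identifiable.mem)
  have hYlaw : ∀ i, HasLaw (Y i)
      (((jointLaw p q).prod (Measure.pi fun _ : Fin m => pv)).map (blockAvg m F)) μ := fun i =>
    HasLaw.comp (Y := blockAvg m F) ⟨hFm.aemeasurable, rfl⟩ (S.hasLaw i)
  have hY0 : MemLp (Y 0) 1 μ := by
    rw [memLp_one_iff_integrable]
    have := integrable_blockAvg (m := m) hstar
    rw [← (S.hasLaw 0).map_eq] at this
    exact this.comp_aemeasurable (S.hasLaw 0).aemeasurable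
  have hE : ∫ ω, Y 0 ω ∂μ = objective (score (pM θstar)) (jointLaw p q) pv := by
    rw [objective, ← integral_blockAvg hm hstar, ← (S.hasLaw 0).map_eq,
      integral_map (S.hasLaw 0).aemeasurable hFm.aestronglyMeasurable]
  have hind : Pairwise (Function.onFun (fun f g => IndepFun f g μ) Y) := fun i j hij =>
    (S.indep.indepFun hij).comp hFm hFm
  have hlln := strong_law_Lp le_rfl ENNReal.one_ne_top Y hY0 hind
    (fun i => ⟨(hYlaw i).aemeasurable, (hYlaw 0).aemeasurable,
      (hYlaw i).map_eq.trans (hYlaw 0).map_eq.symm⟩)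
  simp only [eLpNorm_one_eq_lintegral_enorm, hE, smul_eq_mul, Real.enorm_eq_ofReal_abs] at hlln
  simpa only [empObjective_eq_blockAvg] using hlln

end Assumptions

end CSSM

end

/-! ### The consistency theorem. -/

theorem mainTheorem3 :
    ∃ C : ℝ, ∀ (dx dz d m : ℕ), 0 < m →
    ∀ (Θ : Set (CSSM.E d)) (θstar : CSSM.E d)
      (pM : CSSM.E d → CSSM.E dx → CSSM.E dz → ℝ)
      (p : CSSM.E dx → CSSM.E dz → ℝ) (q : CSSM.E dz → ℝ)
      (pv : Measure (CSSM.E dx)) (L₁ L₂ : CSSM.E dx → CSSM.E dz → ℝ),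
    CSSM.Assumptions Θ θstar pM p q pv L₁ L₂ →
    ∀ (Ω : Type*) [MeasurableSpace Ω] (μ : Measure Ω) [IsProbabilityMeasure μ]
      (X : ℕ → Ω → CSSM.E dx) (Z : ℕ → Ω → CSSM.E dz) (V : ℕ → Fin m → Ω → CSSM.E dx),
    CSSM.IsSample μ (CSSM.jointLaw p q) pv X Z V →
    let J : CSSM.E d → ℝ := fun θ =>
      CSSM.objective (CSSM.score (pM θ)) (CSSM.jointLaw p q) pv
    let Jhat : ℕ → Ω → CSSM.E d → ℝ := fun n ω θ =>
      CSSM.empObjective (CSSM.score (pM θ)) n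
        (fun i => X i ω) (fun i => Z i ω) (fun i j => V i j ω)
    -- consistency of every sequence of minimizers of the empirical objective
    (∀ θhat : ℕ → Ω → CSSM.E d,
      (∀ n, ∀ᵐ ω ∂μ, θhat n ω ∈ Θ ∧ IsMinOn (Jhat n ω) Θ (θhat n ω)) →
      TendstoInMeasure μ θhat atTop (fun _ => θstar)) ∧
    -- uniform convergence of the empirical objective, and its rate, when `J` is well defined
    ((∀ θ ∈ Θ, Integrable (fun w => CSSM.loss (CSSM.score (pM θ)) w.1.1 w.1.2 w.2)
        ((CSSM.jointLaw p q).prod pv)) →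
      Tendsto (fun n => ∫⁻ ω, ⨆ θ ∈ Θ, ENNReal.ofReal |Jhat n ω θ - J θ| ∂μ) atTop (𝓝 0) ∧
      ∀ n : ℕ, 0 < n →
        ∫⁻ ω, ⨆ θ ∈ Θ,
            ENNReal.ofReal |(Jhat n ω θ - J θ) - (Jhat n ω θstar - J θstar)| ∂μ ≤
          ENNReal.ofReal (C * Metric.diam Θ * √((d : ℝ) / n) *
            √(∫ w, CSSM.lossLipschitz L₁ L₂ w.1.1 w.1.2 w.2 ^ 2
              ∂((CSSM.jointLaw p q).prod pv)))) := by
  -- The chaining constant 13 times the factor 2 from symmetrization.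
  refine ⟨26, ?_⟩
  intro dx dz d m hm Θ θstar pM p q pv L₁ L₂ A Ω _ μ _ X Z V S J Jhat
  refine ⟨fun θhat hmin => A.tendstoInMeasure hm S hmin, fun hint => ?_⟩
  have hstar := A.identifiable.mem
  have hJ : ∀ θ ∈ Θ, J θ - J θstar =
      ∫ w, CSSM.Assumptions.excess pM θstar θ w ∂((CSSM.jointLaw p q).prod pv) := fun θ hθ =>
    (integral_sub (hint θ hθ) (hint θstar hstar)).symm
  constructor
  · have hlim := (CSSM.Assumptions.tendsto_rate (d := d) (Metric.diam Θ)
      (√(∫ w, CSSM.lossLipschitz L₁ L₂ w.1.1 w.1.2 w.2 ^ 2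
        ∂((CSSM.jointLaw p q).prod pv)))).add
      (A.tendsto_lintegral_empObjective_sub hm S (hint θstar hstar))
    rw [add_zero] at hlim
    refine tendsto_of_tendsto_of_tendsto_of_le_of_le' tendsto_const_nhds hlim
      (Eventually.of_forall fun _ => zero_le) ?_
    filter_upwards [eventually_gt_atTop 0] with n hn
    obtain ⟨H, hH, hle, hHint⟩ := A.exists_majorant hm S hn
    -- The deviation at `θ` is the deviation of the excess plus that at `θstar`. Measurability is
    -- needed only for `H`, to split the integral of the sum, and not for the supremum.
    calc ∫⁻ ω, ⨆ θ ∈ Θ, ENNReal.ofReal |Jhat n ω θ - J θ| ∂μ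
        ≤ ∫⁻ ω, (H ω + ENNReal.ofReal |Jhat n ω θstar - J θstar|) ∂μ := by
          refine lintegral_mono fun ω => iSup₂_le fun θ hθ => ?_
          refine le_trans ?_ (add_le_add (hle ω θ hθ) le_rfl)
          rw [← ENNReal.ofReal_add (abs_nonneg _) (abs_nonneg _), ← hJ θ hθ]
          refine ENNReal.ofReal_le_ofReal (le_trans (le_of_eq ?_) (abs_add_le _ _))
          congr 1
          simp only [Jhat]
          ring
      _ = ∫⁻ ω, H ω ∂μ + ∫⁻ ω, ENNReal.ofReal |Jhat n ω θstar - J θstar| ∂μ :=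
          lintegral_add_left' hH _
      _ ≤ _ := add_le_add hHint le_rfl
  · intro n hn
    obtain ⟨H, hH, hle, hHint⟩ := A.exists_majorant hm S hn
    refine (lintegral_mono fun ω => iSup₂_le fun θ hθ => ?_).trans hHint
    refine le_trans (ENNReal.ofReal_le_ofReal (le_of_eq ?_)) (hle ω θ hθ)
    rw [← hJ θ hθ]
    congr 1
    simp only [Jhat]
    ring
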